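/- Fix integers $d\ge 1$, $r\ge 0$ and reals $\alpha>0$, $C_0\ge 2$. Let $\lfloor\alpha\rfloor$ be the largest integer strictly less than $\alpha$ and assume $r\ge\lfloor\alpha\rfloor$. Norms on $\mathbb R^d$ are sup norms. *Images.* $\mathcal H_d(\alpha,C_0)$ is the set of $g:[0,1]^d\to[0,1]$ that are $\lfloor\alpha\rfloor$ times (continuously) differentiable, with $|g^{(s)}|\le C_0$ for $1\le|s|\le\lfloor\alpha\rfloor$ and $|g^{(s)}(x)-g^{(s)}(x')|\le C_0\|x-x'\|^{\alpha-\lfloor\alpha\rfloor}$ for $|s|=\lfloor\alpha\rfloor$. The cartoon class $\mathcal F=\mathcal F^{\rm cartoon}(\alpha,C_0)$ consists of the functions $f=\mathbf 1_{\Omega}f_\Omega+\mathbf 1_{\Omega^c}f_{\Omega^c}$ on $[0,1]^d$ with $f_\Omega,f_{\Omega^c}\in\mathcal H_d(\alpha,C_0)$, $|f_\Omega-f_{\Omega^c}|\ge 1/C_0$ on $\partial\Omega$, and $\Omega\subset(0,1)^d$ the image of the open Euclidean unit ball under an injective map $\phi:\mathbb R^d\to\mathbb R^d$ such that $\phi$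 and $\phi^{-1}$ are $C_0$-Lipschitz. ($C_0\ge2$ says exactly that $\mathcal F\neq\emptyset$.) *Observations.* For $i\in\{1,\dots,n\}^d$ let $x_i=((i_1-\frac12)/n,\dots,(i_d-\frac12)/n)$ and $y_i=f(x_i)+\varepsilon_i$, where the $\varepsilon_i$ are uncorrelated with mean $0$ and variance $\sigma^2>0$. *Estimator.* For $h>0$ put $\omega_{i,j}=1$ if $\|x_i-x_j\|\le h$ and $x_i,x_j$ are both in $\Omega$ or both in $\Omega^c$, and $\omega_{i,j}=0$ otherwise. The membership-oracle estimator $\widehat f_i$ is the constant coefficient $\widehat a_0$ of a minimiser over $(a_s)_{|s|\le r}$ of $\sum_j\omega_{i,j}\big(y_j-\sum_{|s|\le r}a_s(x_j-x_i)^s\big)^2$ (and $\widehat f_i=y_i$ if the minimisation does not determine $\widehat a_0$ uniquely). We consider both this estimator and its clipped version, with values truncated to $[0,1]$. Let $\mathcal R_n(h)=\sup_{f\in\mathcal F}n^{-d}\sum_i\mathbb E(\widehat f_i-f(x_i))^2$, and $$\mathcal R^{\rm MO}=(\sigma^2/n^d)^{2\alpha/(d+2\alpha)},\qquad h^{\rm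 MO}=(\sigma^2/n^d)^{1/(d+2\alpha)} .$$ **Theorem.** (1) *Upper bound.* For the clipped and the unclipped estimator there is $C$, depending only on $d,r,\alpha,C_0$, such that $\inf_{h>0}\mathcal R_n(h)\le C\,\mathcal R^{\rm MO}$ for all $n\ge1$, all $\sigma>0$ with $h^{\rm MO}\le1$, and all noise as above. It is attained by every $h\asymp h^{\rm MO}$: for all $0<a\le b$ there is $C$, depending only on $a,b,d,r,\alpha,C_0$, such that $\mathcal R_n(h)\le C\,\mathcal R^{\rm MO}$ whenever $a h^{\rm MO}\le h\le b h^{\rm MO}$, under the same conditions. (2) *Lower bound and optimal bandwidths.* Consider either the unclipped estimator, with all noise as above, or the clipped estimator, with noise $\varepsilon_i=\sigma\xi_i$ where the $\xi_i$ are i.i.d. with a fixed law of mean $0$ and variance $1$ (for instance Gaussian). Then there are $M,c>0$ with $$\inf_{h>0}\mathcal R_n(h)\ \ge\ c\,\mathcal R^{\rm MO}\qquad\text{whenever } M/n\le h^{\rm MO}\le 1/M .$$ Moreover, for every $K\ge1$ there are $M>0$ and $0<a\le b$ such that, whenever $M/n\le h^{\rm MO}\le1/M$, every $h>0$ with $\mathcal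 R_n(h)\le K\inf_{h'>0}\mathcal R_n(h')$ satisfies $a h^{\rm MO}\le h\le b h^{\rm MO}$. The constants depend only on $d,r,\alpha,C_0$, on $K$ for the last claim, and on the law of $\xi_i$ in the clipped case. In particular, for fixed $\sigma$ (where $M/n\le h^{\rm MO}\le1/M$ holds for all large $n$), $\inf_h\mathcal R_n(h)\asymp\mathcal R^{\rm MO}$, and the optimal bandwidth is $h\asymp h^{\rm MO}$. -/

import Mathlib

open MeasureTheory ProbabilityTheory
open scoped ENNReal

namespace MembershipOracle

/-! ### Hölder functions and cartoon images

Points of `ℝ^d` are functions `Fin d → ℝ`, whose norm is the sup norm. -/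

/-- The closed unit cube `[0,1]^d`. -/
def cube (d : ℕ) : Set (Fin d → ℝ) := Set.Icc 0 1

/-- The largest integer strictly less than `α` (for `α > 0`). -/
noncomputable def holderOrder (α : ℝ) : ℕ := ⌈α⌉₊ - 1

/-- The mixed partial derivative `∂_{v 0} ⋯ ∂_{v (k-1)} g (x)` of order `k`, one-sided on the
boundary of the cube. The sequence `v` of directions represents the multi-index which counts how
often each direction occurs; every multi-index of length `k` arises in this way. -/
noncomputable def partialDeriv {d k : ℕ} (v : Fin k → Fin d) (g : (Fin d → ℝ) → ℝ)
    (x : Fin d → ℝ) : ℝ :=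
  iteratedFDerivWithin ℝ k g (cube d) x (fun m => Pi.single (v m) 1)

/-- `g` restricted to `[0,1]^d` belongs to the Hölder class of exponent `α` and radius `C₀`, with
values in `[0,1]`. -/
structure IsHolder (d : ℕ) (α C₀ : ℝ) (g : (Fin d → ℝ) → ℝ) : Prop where
  mem_Icc : ∀ x ∈ cube d, g x ∈ Set.Icc (0 : ℝ) 1
  contDiffOn : ContDiffOn ℝ (holderOrder α) g (cube d)
  bound : ∀ x ∈ cube d, ∀ k : ℕ, 1 ≤ k → k ≤ holderOrder α → ∀ v : Fin k → Fin d,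
    |partialDeriv v g x| ≤ C₀
  holder : ∀ x ∈ cube d, ∀ x' ∈ cube d, ∀ v : Fin (holderOrder α) → Fin d,
    |partialDeriv v g x - partialDeriv v g x'| ≤ C₀ * ‖x - x'‖ ^ (α - holderOrder α)

/-- A cartoon image: a foreground region `Ω`, which is a bi-Lipschitz image of the open Euclidean
unit ball, with Hölder functions on the foreground and the background and with a jump of at least
`1 / C₀` along the boundary of `Ω`. -/
structure CartoonImage (d : ℕ) (α C₀ : ℝ) where
  Ω : Set (Fin d → ℝ)
  fg : (Fin d → ℝ) → ℝ
  bg : (Fin d → ℝ) → ℝ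
  holder_fg : IsHolder d α C₀ fg
  holder_bg : IsHolder d α C₀ bg
  jump : ∀ x ∈ frontier Ω, 1 / C₀ ≤ |fg x - bg x|
  subset : ∀ x ∈ Ω, ∀ k, x k ∈ Set.Ioo (0 : ℝ) 1
  biLipschitz : ∃ φ : (Fin d → ℝ) → (Fin d → ℝ), Function.Injective φ ∧
    (∀ u v, ‖φ u - φ v‖ ≤ C₀ * ‖u - v‖) ∧ (∀ u v, ‖u - v‖ ≤ C₀ * ‖φ u - φ v‖) ∧
    Ω = φ '' {u | ∑ k, u k ^ 2 < 1}

/-- The image `f = 1_Ω f_Ω + 1_{Ωᶜ} f_{Ωᶜ}`. -/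
noncomputable def CartoonImage.toFun {d : ℕ} {α C₀ : ℝ} (F : CartoonImage d α C₀)
    (x : Fin d → ℝ) : ℝ :=
  F.Ω.indicator F.fg x + F.Ωᶜ.indicator F.bg x

/-! ### The sampling grid and the noise -/

/-- Indices of the pixels. -/
abbrev Grid (d n : ℕ) : Type := Fin d → Fin n

/-- The sample points: `Fin n` is `{0, …, n-1}`, so coordinate `k` is `(i k + 1/2) / n`. -/
noncomputable def pt {d n : ℕ} (i : Grid d n) : Fin d → ℝ := fun k => ((i k : ℝ) + 1 / 2) / n

/-- The laws of noise vectors whose entries are uncorrelated, with mean `0` and variance `σ²`. -/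
def whiteNoise (d n : ℕ) (σ : ℝ) : Set (Measure (Grid d n → ℝ)) :=
  {P | IsProbabilityMeasure P ∧ (∀ i, MemLp (fun ε => ε i) 2 P) ∧ (∀ i, ∫ ε, ε i ∂P = 0) ∧
    ∀ i j, ∫ ε, ε i * ε j ∂P = if i = j then σ ^ 2 else 0}

/-- A standardized law on the real line: mean `0` and variance `1`. -/
def IsStandardized (ν : Measure ℝ) : Prop :=
  IsProbabilityMeasure ν ∧ MemLp (fun t : ℝ => t) 2 ν ∧ ∫ t, t ∂ν = 0 ∧ ∫ t, t ^ 2 ∂ν = 1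

/-- The law of a noise vector with independent entries distributed as `σ ξ`, where `ξ` has
law `ν`. -/
noncomputable def iidNoise (ν : Measure ℝ) (d n : ℕ) (σ : ℝ) : Set (Measure (Grid d n → ℝ)) :=
  {Measure.pi fun _ => ν.map fun t => σ * t}

/-! ### Local polynomial regression -/

/-- Multi-indices `s ∈ ℕ^d` with `|s| ≤ r`. -/
abbrev MultiIndex (d r : ℕ) : Type := {s : Fin d → Fin (r + 1) // ∑ k, (s k : ℕ) ≤ r}

/-- The multi-index `0`. -/
def MultiIndex.zero (d r : ℕ) : MultiIndex d r := ⟨fun _ => 0, by simp⟩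

/-- The weighted residual sum of squares, at pixel `i`, of the polynomial with coefficients `a`. -/
noncomputable def lprLoss {d n r : ℕ} (ω : Grid d n → Grid d n → ℝ) (y : Grid d n → ℝ)
    (i : Grid d n) (a : MultiIndex d r → ℝ) : ℝ :=
  ∑ j, ω i j * (y j - ∑ s, a s * ∏ k, (pt j k - pt i k) ^ (s.1 k : ℕ)) ^ 2

/-- `v` is the constant coefficient of a weighted least squares fit at pixel `i`. -/
def IsLPRValue {d n : ℕ} (r : ℕ) (ω : Grid d n → Grid d n → ℝ) (y : Grid d n → ℝ)
    (i : Grid d n) (v : ℝ) : Prop :=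
  ∃ a : MultiIndex d r → ℝ, (∀ b : MultiIndex d r → ℝ, lprLoss ω y i a ≤ lprLoss ω y i b) ∧
    a (MultiIndex.zero d r) = v

open Classical in
/-- The local polynomial estimator of degree `r` with weights `ω`: the fitted constant coefficient
if the fit determines it uniquely, and the observation itself otherwise. -/
noncomputable def lpr {d n : ℕ} (r : ℕ) (ω : Grid d n → Grid d n → ℝ) (y : Grid d n → ℝ)
    (i : Grid d n) : ℝ :=
  if h : ∃! v, IsLPRValue r ω y i v then h.choose else y i

open Classical in
/-- Membership oracle weights: the box kernel of bandwidth `h`, restricted to pairs of pixels on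
the same side of the discontinuity. -/
noncomputable def moWeight {d n : ℕ} (Ω : Set (Fin d → ℝ)) (h : ℝ) (i j : Grid d n) : ℝ :=
  if ‖pt i - pt j‖ ≤ h ∧ (pt i ∈ Ω ↔ pt j ∈ Ω) then 1 else 0

/-- The membership oracle estimator, clipped to `[0,1]` if `clip = true`. -/
noncomputable def moEstimator {d n : ℕ} (clip : Bool) (r : ℕ) (Ω : Set (Fin d → ℝ)) (h : ℝ)
    (y : Grid d n → ℝ) (i : Grid d n) : ℝ :=
  if clip then max 0 (min 1 (lpr r (moWeight Ω h) y i)) else lpr r (moWeight Ω h) y i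

/-! ### Risks and rates -/

/-- Mean squared error on the grid of the estimator `fhat` of `f`, when the noise has law `P`. -/
noncomputable def mse {d n : ℕ} (P : Measure (Grid d n → ℝ))
    (fhat : (Grid d n → ℝ) → Grid d n → ℝ) (f : (Fin d → ℝ) → ℝ) : ℝ≥0∞ :=
  (∑ i, ∫⁻ ε, ENNReal.ofReal ((fhat (fun j => f (pt j) + ε j) i - f (pt i)) ^ 2) ∂P) /
    (n : ℝ≥0∞) ^ d

/-- Worst-case mean squared error, over the cartoon images, of the membership oracle estimator of
degree `r` and bandwidth `h`. -/
noncomputable def moRisk {d n : ℕ} (clip : Bool) (r : ℕ) (α C₀ : ℝ) (P : Measure (Grid d n → ℝ))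
    (h : ℝ) : ℝ≥0∞ :=
  ⨆ F : CartoonImage d α C₀, mse P (moEstimator clip r F.Ω h) F.toFun

/-- The worst-case mean squared error optimised over the bandwidth. -/
noncomputable def moBestRisk {d n : ℕ} (clip : Bool) (r : ℕ) (α C₀ : ℝ)
    (P : Measure (Grid d n → ℝ)) : ℝ≥0∞ :=
  ⨅ (h : ℝ) (_ : 0 < h), moRisk clip r α C₀ P h

/-- The rate `(σ² / n^d)^(2α / (d + 2α))`. -/
noncomputable def rateMO (d n : ℕ) (α σ : ℝ) : ℝ := (σ ^ 2 / (n : ℝ) ^ d) ^ (2 * α / (d + 2 * α))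

/-- The bandwidth `(σ² / n^d)^(1 / (d + 2α))`. -/
noncomputable def hMO (d n : ℕ) (α σ : ℝ) : ℝ := (σ ^ 2 / (n : ℝ) ^ d) ^ (1 / (d + 2 * α))

end MembershipOracle

namespace MembershipOracle

/-! ### Least squares on a finite set of pixels -/

section LeastSquares

/-! The estimator at pixel `i` is linear in the observations. Its weights are the projection of the
`i`-th unit vector onto the polynomials restricted to the window of `i`. They reproduce polynomials
of degree at most `r`, and their squares sum to the weight of `i` itself, the leverage. The variance
is therefore `σ²` times the leverage. By Cauchy-Schwarz, the squared bias is at most the leverage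
times the window size times the squared Taylor remainder, which is of order `h ^ (2α)`.

Everything now rests on the sum of the leverages. No Gram matrix is bounded from below, and the
boundary of `Ω` needs no regularity. Let `t` be the bandwidth in pixels and cut the grid into cells
of side `t`, each split into its parts inside and outside `Ω`. Each part lies in the window of every
one of its pixels. Leverages only grow when data are discarded or the model is enlarged, so inside a
part they are at most those of a single global polynomial fit to that part, which sum to at most the
dimension (a trace). Hence the sum is `O((n/t)^d)` for every `Ω` (`sum_leverage_le`). This gives
risk `O(h ^ (2α) + σ² / (n h)^d)`, balanced at `hMO`.

For the lower bounds, the weights sum to one, so each leverage is at least the inverse window size,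
and the variance cannot be much below `σ² / t ^ d` (`ofReal_variance_le_moRisk`). For the bias,
foreground and background carry a train of bumps in one coordinate, of width `ρ`, a small multiple
of `t / n`, and of height of order `ρ ^ α`. The slab under one bump is a small fraction of a window,
so by the leverage sum the fit smooths the bump away at most pixels. Averaging over all subsets of
bumps prevents the bumps from cancelling each other's bias (`exists_ofReal_bias_le_moRisk`).
Comparing both bounds with the upper bound forces `h` to be of order `hMO`.

Clipping can only help the upper bound. For the lower bounds, `IsDetected` isolates what is needed
of the noise: a saturated risk that sees both bias and variance. For clipped i.i.d. noise it is
obtained from characteristic functions, with a constant depending only on the law. -/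

lemma inner_euclidean {ι : Type*} [Fintype ι] (x y : EuclideanSpace ℝ ι) : inner ℝ x y = ∑ j, x j * y j := by
  rw [PiLp.inner_apply]
  exact Finset.sum_congr rfl fun j _ => by simp [mul_comm]

variable {ι : Type*} [DecidableEq ι]

/-- Restriction of a function to a finite set, extended by zero. -/
noncomputable def restrictTo (W : Finset ι) : (ι → ℝ) →ₗ[ℝ] EuclideanSpace ℝ ι where
  toFun f := WithLp.toLp 2 fun j => if j ∈ W then f j else 0
  map_add' f g := by
    ext j
    by_cases hj : j ∈ W <;> simp [hj]
  map_smul' c f := by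
    ext j
    by_cases hj : j ∈ W <;> simp [hj]

@[simp] lemma restrictTo_apply (W : Finset ι) (f : ι → ℝ) (j : ι) :
    restrictTo W f j = if j ∈ W then f j else 0 := rfl

variable [Fintype ι]

/-- Weights of the least squares fit at `i` from the model `U` and the observations in `W`. -/
noncomputable def hatWeight (U : Submodule ℝ (ι → ℝ)) (W : Finset ι) (i j : ι) : ℝ :=
  (U.map (restrictTo W)).starProjection (EuclideanSpace.single i (1 : ℝ)) j

variable (U : Submodule ℝ (ι → ℝ)) (W : Finset ι)

/-- The weights are themselves a restricted element of the model, so the reproducing property can be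
applied to them. -/
lemma exists_hatWeight_eq (i : ι) :
    ∃ u ∈ U, ∀ j, hatWeight U W i j = if j ∈ W then u j else 0 := by
  obtain ⟨u, hu, he⟩ := Submodule.mem_map.1
    ((U.map (restrictTo W)).starProjection_apply_mem (EuclideanSpace.single i (1 : ℝ)))
  refine ⟨u, hu, fun j => ?_⟩
  rw [hatWeight, ← he, restrictTo_apply]

lemma hatWeight_eq_zero {i j : ι} (hj : j ∉ W) : hatWeight U W i j = 0 := by
  obtain ⟨u, -, h⟩ := exists_hatWeight_eq U W i
  rw [h, if_neg hj]

/-- The fitted value at `i` is the inner product of the weights with the observations. -/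
lemma sum_hatWeight_mul (i : ι) (y : ι → ℝ) :
    ∑ j, hatWeight U W i j * y j = (U.map (restrictTo W)).starProjection (restrictTo W y) i := by
  have h1 : ∑ j, hatWeight U W i j * y j = ∑ j, hatWeight U W i j * restrictTo W y j := by
    refine Finset.sum_congr rfl fun j _ => ?_
    by_cases hj : j ∈ W
    · simp [hj]
    · simp [hj, hatWeight_eq_zero U W hj]
  have h2 := Submodule.inner_starProjection_left_eq_right (U.map (restrictTo W))
    (EuclideanSpace.single i (1 : ℝ)) (restrictTo W y)
  rw [EuclideanSpace.inner_single_left, inner_euclidean] at h2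
  rw [h1]
  simpa [hatWeight] using h2

/-- Reproducing property: the projection fixes the restricted model, and `i ∈ W` lets the value at
`i` be read off. -/
lemma sum_hatWeight_mul_mem {i : ι} (hi : i ∈ W) {u : ι → ℝ} (hu : u ∈ U) :
    ∑ j, hatWeight U W i j * u j = u i := by
  rw [sum_hatWeight_mul, Submodule.starProjection_eq_self_iff.2 (Submodule.mem_map_of_mem hu)]
  simp [hi]

/-- The weights reproduce themselves. This identifies the variance factor with the leverage. -/
lemma sum_hatWeight_sq {i : ι} (hi : i ∈ W) :
    ∑ j, hatWeight U W i j ^ 2 = hatWeight U W i i := by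
  obtain ⟨u, hu, h⟩ := exists_hatWeight_eq U W i
  have h1 := sum_hatWeight_mul_mem U W hi hu
  rw [h i, if_pos hi, ← h1]
  refine Finset.sum_congr rfl fun j _ => ?_
  rw [h j]
  split_ifs <;> ring

lemma hatWeight_self_nonneg {i : ι} (hi : i ∈ W) : 0 ≤ hatWeight U W i i := by
  rw [← sum_hatWeight_sq U W hi]
  positivity

lemma hatWeight_self_le_one {i : ι} (hi : i ∈ W) : hatWeight U W i i ≤ 1 := by
  have h := sum_hatWeight_sq U W hi
  have h2 : hatWeight U W i i ^ 2 ≤ ∑ j, hatWeight U W i j ^ 2 :=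
    Finset.single_le_sum (f := fun j => hatWeight U W i j ^ 2) (fun j _ => sq_nonneg _)
      (Finset.mem_univ i)
  nlinarith

/-- Cauchy-Schwarz against the weights. The set `T` records where `g` lives: the whole window for
Taylor remainders and constants, a thin slab for a single bump. -/
lemma sq_sum_hatWeight_mul_le {i : ι} (hi : i ∈ W) (T : Finset ι) {g : ι → ℝ}
    (hg : ∀ j, j ∈ W → j ∉ T → g j = 0) {B : ℝ} (hB : ∀ j ∈ W, g j ^ 2 ≤ B) :
    (∑ j, hatWeight U W i j * g j) ^ 2 ≤ B * (W ∩ T).card * hatWeight U W i i := by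
  have h1 : ∑ j, hatWeight U W i j * g j = ∑ j ∈ W ∩ T, hatWeight U W i j * g j := by
    symm
    refine Finset.sum_subset (Finset.subset_univ _) fun j _ hj => ?_
    by_cases hjW : j ∈ W
    · rw [hg j hjW fun h => hj (Finset.mem_inter.2 ⟨hjW, h⟩), mul_zero]
    · rw [hatWeight_eq_zero U W hjW, zero_mul]
  rw [h1]
  have h2 : ∑ j ∈ W ∩ T, hatWeight U W i j ^ 2 ≤ hatWeight U W i i := by
    rw [← sum_hatWeight_sq U W hi]
    exact Finset.sum_le_sum_of_subset_of_nonneg (Finset.subset_univ _)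
      fun j _ _ => sq_nonneg _
  have h3 : ∑ j ∈ W ∩ T, g j ^ 2 ≤ B * (W ∩ T).card := by
    have := Finset.sum_le_card_nsmul (W ∩ T) (fun j => g j ^ 2) B
      fun j hj => hB j (Finset.mem_inter.1 hj).1
    rwa [nsmul_eq_mul, mul_comm] at this
  calc _ ≤ (∑ j ∈ W ∩ T, hatWeight U W i j ^ 2) * ∑ j ∈ W ∩ T, g j ^ 2 :=
        Finset.sum_mul_sq_le_sq_mul_sq _ _ _
    _ ≤ hatWeight U W i i * (B * (W ∩ T).card) :=
        mul_le_mul h2 h3 (by positivity) (hatWeight_self_nonneg U W hi)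
    _ = _ := by ring

/-- Leverages decrease when observations are added or when the model shrinks. -/
lemma hatWeight_self_mono {U' : Submodule ℝ (ι → ℝ)} {Q : Finset ι} (hU : U ≤ U') (hQ : Q ⊆ W)
    {i : ι} (hi : i ∈ Q) : hatWeight U W i i ≤ hatWeight U' Q i i := by
  obtain ⟨u, hu, h⟩ := exists_hatWeight_eq U W i
  have h1 := sum_hatWeight_mul_mem U' Q hi (hU hu)
  -- The larger model, fitted on fewer data, reproduces the weights `u` of the smaller one.
  -- Cauchy-Schwarz then bounds the square of the old leverage by the product of both leverages.
  have h2 : (∑ j, hatWeight U' Q i j * u j) ^ 2 ≤ hatWeight U' Q i i * hatWeight U W i i := by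
    have e : ∑ j, hatWeight U' Q i j * u j = ∑ j ∈ Q, hatWeight U' Q i j * u j := by
      symm
      refine Finset.sum_subset (Finset.subset_univ _) fun j _ hj => ?_
      rw [hatWeight_eq_zero U' Q hj, zero_mul]
    rw [e]
    refine (Finset.sum_mul_sq_le_sq_mul_sq _ _ _).trans ?_
    refine mul_le_mul ?_ ?_ (by positivity) (hatWeight_self_nonneg U' Q hi)
    · rw [← sum_hatWeight_sq U' Q hi]
      exact Finset.sum_le_sum_of_subset_of_nonneg (Finset.subset_univ _)
        fun j _ _ => sq_nonneg _
    · rw [← sum_hatWeight_sq U W (hQ hi)]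
      refine (Finset.sum_le_sum fun j hj => ?_).trans
        (Finset.sum_le_sum_of_subset_of_nonneg (Finset.subset_univ Q) fun j _ _ => sq_nonneg _)
      rw [h j, if_pos (hQ hj)]
  have h3 : hatWeight U W i i = u i := by rw [h i, if_pos (hQ hi)]
  rw [h1, ← h3] at h2
  have h4 := hatWeight_self_nonneg U W (hQ hi)
  have h5 := hatWeight_self_nonneg U' Q hi
  by_contra hlt
  push Not at hlt
  nlinarith

/-- The leverages sum up to the dimension of the model. -/
lemma sum_hatWeight_self_le : ∑ i, hatWeight U W i i ≤ Module.finrank ℝ U := by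
  set V := U.map (restrictTo W) with hV
  let b := stdOrthonormalBasis ℝ V
  -- The leverages are the diagonal of a projection; in an orthonormal basis their sum becomes the
  -- trace.
  have h1 : ∀ i, hatWeight U W i i = ∑ k, (b k : EuclideanSpace ℝ ι) i ^ 2 := by
    intro i
    have h := congrArg V.subtype
      (b.sum_repr (V.orthogonalProjectionOnto (EuclideanSpace.single i (1 : ℝ))))
    rw [map_sum] at h
    have h' : V.starProjection (EuclideanSpace.single i (1 : ℝ)) =
        ∑ k, b.repr (V.orthogonalProjectionOnto (EuclideanSpace.single i (1 : ℝ))) k •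
          (b k : EuclideanSpace ℝ ι) := h.symm
    change V.starProjection (EuclideanSpace.single i (1 : ℝ)) i = _
    rw [h']
    simp only [WithLp.ofLp_sum, Finset.sum_apply, WithLp.ofLp_smul, Pi.smul_apply, smul_eq_mul]
    refine Finset.sum_congr rfl fun k _ => ?_
    rw [OrthonormalBasis.repr_apply_apply]
    change inner ℝ (b k : EuclideanSpace ℝ ι)
      (V.starProjection (EuclideanSpace.single i (1 : ℝ))) * _ = _
    rw [← Submodule.inner_starProjection_left_eq_right,
      Submodule.starProjection_eq_self_iff.2 (b k).2, EuclideanSpace.inner_single_right]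
    simp [sq]
  rw [Finset.sum_congr rfl fun i _ => h1 i, Finset.sum_comm]
  have h2 : ∀ k, ∑ i, (b k : EuclideanSpace ℝ ι) i ^ 2 = 1 := by
    intro k
    have h := b.orthonormal.1 k
    rw [Submodule.norm_coe (b k) |>.symm, EuclideanSpace.norm_eq] at h
    have := Real.sqrt_eq_one.1 h
    simpa using this
  rw [Finset.sum_congr rfl fun k _ => h2 k]
  simp only [Finset.sum_const, Finset.card_univ, Fintype.card_fin, nsmul_eq_mul, mul_one]
  exact_mod_cast Submodule.finrank_map_le (restrictTo W) U

end LeastSquares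

/-! ### The local polynomial estimator is linear in the observations -/

section Linear

variable {d n : ℕ}

/-- The values on the grid of the polynomials with coefficients `a`, centred at pixel `i`. -/
noncomputable def design (r : ℕ) (i : Grid d n) : (MultiIndex d r → ℝ) →ₗ[ℝ] (Grid d n → ℝ) where
  toFun a j := ∑ s, a s * ∏ k, (pt j k - pt i k) ^ (s.1 k : ℕ)
  map_add' a b := by
    ext j
    simp [add_mul, Finset.sum_add_distrib]
  map_smul' c a := by
    ext j
    simp [Finset.mul_sum, mul_assoc]

lemma design_apply (r : ℕ) (i j : Grid d n) (a : MultiIndex d r → ℝ) :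
    design r i a j = ∑ s, a s * ∏ k, (pt j k - pt i k) ^ (s.1 k : ℕ) := rfl

/-- Polynomials of degree at most `r`, as functions on the grid, spanned by the monomials centred
at `i`. -/
noncomputable def localPoly (r : ℕ) (i : Grid d n) : Submodule ℝ (Grid d n → ℝ) :=
  LinearMap.range (design r i)

open Classical in
/-- The pixels used by the membership oracle at pixel `i`. -/
noncomputable def window (Ω : Set (Fin d → ℝ)) (h : ℝ) (i : Grid d n) : Finset (Grid d n) :=
  Finset.univ.filter fun j => ‖pt i - pt j‖ ≤ h ∧ (pt i ∈ Ω ↔ pt j ∈ Ω)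

lemma mem_window {Ω : Set (Fin d → ℝ)} {h : ℝ} {i j : Grid d n} :
    j ∈ window Ω h i ↔ ‖pt i - pt j‖ ≤ h ∧ (pt i ∈ Ω ↔ pt j ∈ Ω) := by
  classical simp [window]

lemma self_mem_window (Ω : Set (Fin d → ℝ)) {h : ℝ} (hh : 0 < h) (i : Grid d n) :
    i ∈ window Ω h i := by
  simp [mem_window, hh.le]

lemma design_self (r : ℕ) (i : Grid d n) (a : MultiIndex d r → ℝ) :
    design r i a i = a (MultiIndex.zero d r) := by
  rw [design_apply, Finset.sum_eq_single (MultiIndex.zero d r)]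
  · simp [MultiIndex.zero]
  · intro s _ hs
    have : ∃ k, s.1 k ≠ 0 := by
      by_contra hcon
      push Not at hcon
      exact hs (Subtype.ext (funext hcon))
    obtain ⟨k, hk⟩ := this
    rw [Finset.prod_eq_zero (Finset.mem_univ k), mul_zero]
    rw [sub_self, zero_pow]
    exact fun h0 => hk (Fin.ext h0)
  · simp

lemma lprLoss_eq_norm_sq (r : ℕ) (Ω : Set (Fin d → ℝ)) (h : ℝ) (y : Grid d n → ℝ) (i : Grid d n)
    (a : MultiIndex d r → ℝ) :
    lprLoss (moWeight Ω h) y i a =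
      ‖restrictTo (window Ω h i) y - restrictTo (window Ω h i) (design r i a)‖ ^ 2 := by
  rw [EuclideanSpace.norm_sq_eq]
  refine Finset.sum_congr rfl fun j _ => ?_
  rw [← design_apply]
  by_cases hj : j ∈ window Ω h i
  · have h1 : moWeight Ω h i j = 1 := if_pos (mem_window.1 hj)
    simp [h1, hj]
  · have h1 : moWeight Ω h i j = 0 := if_neg fun hc => hj (mem_window.2 hc)
    simp [h1, hj]

/-- By Pythagoras, the minimisers are exactly the coefficients whose fit is the projection of the
data. These may fail to be unique, but the constant coefficient is the fitted value at `i`, a pixel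
of the window, and so is determined. -/
lemma isLPRValue_iff (r : ℕ) (Ω : Set (Fin d → ℝ)) {h : ℝ} (hh : 0 < h) (y : Grid d n → ℝ)
    (i : Grid d n) (v : ℝ) :
    IsLPRValue r (moWeight Ω h) y i v ↔
      v = ∑ j, hatWeight (localPoly r i) (window Ω h i) i j * y j := by
  set W := window Ω h i
  set V := (localPoly r i).map (restrictTo W)
  have hi : i ∈ W := self_mem_window Ω hh i
  have hmem : ∀ a, restrictTo W (design r i a) ∈ V := fun a =>
    Submodule.mem_map_of_mem (LinearMap.mem_range_self _ a)
  have hpyth : ∀ a, lprLoss (moWeight Ω h) y i a =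
      ‖restrictTo W y - V.starProjection (restrictTo W y)‖ ^ 2 +
      ‖V.starProjection (restrictTo W y) - restrictTo W (design r i a)‖ ^ 2 := by
    intro a
    rw [lprLoss_eq_norm_sq, ← sub_add_sub_cancel _ (V.starProjection (restrictTo W y)), sq, sq, sq]
    refine norm_add_sq_eq_norm_sq_add_norm_sq_real ?_
    exact V.starProjection_inner_eq_zero _ _
      (V.sub_mem (V.starProjection_apply_mem _) (hmem a))
  obtain ⟨u, ⟨a₀, rfl⟩, ha₀⟩ := Submodule.mem_map.1 (V.starProjection_apply_mem (restrictTo W y))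
  have hval : ∀ a, restrictTo W (design r i a) = V.starProjection (restrictTo W y) →
      a (MultiIndex.zero d r) = ∑ j, hatWeight (localPoly r i) W i j * y j := by
    intro a ha
    rw [sum_hatWeight_mul, ← ha, restrictTo_apply, if_pos hi, design_self]
  constructor
  · rintro ⟨a, hmin, rfl⟩
    refine hval a ?_
    have h1 := hmin a₀
    rw [hpyth, hpyth, ha₀, sub_self, norm_zero] at h1
    have h2 : ‖V.starProjection (restrictTo W y) - restrictTo W (design r i a)‖ = 0 := by
      nlinarith [norm_nonneg (V.starProjection (restrictTo W y) - restrictTo W (design r i a))]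
    exact (sub_eq_zero.1 (norm_eq_zero.1 h2)).symm
  · rintro rfl
    refine ⟨a₀, fun b => ?_, hval a₀ ha₀⟩
    rw [hpyth, hpyth, ha₀, sub_self, norm_zero]
    nlinarith [sq_nonneg ‖V.starProjection (restrictTo W y) - restrictTo W (design r i b)‖]

/-- The window contains its own pixel, so the fit always determines the constant coefficient. -/
lemma lpr_eq_sum (r : ℕ) (Ω : Set (Fin d → ℝ)) {h : ℝ} (hh : 0 < h) (y : Grid d n → ℝ)
    (i : Grid d n) :
    lpr r (moWeight Ω h) y i = ∑ j, hatWeight (localPoly r i) (window Ω h i) i j * y j := by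
  have hex : ∃! v, IsLPRValue r (moWeight Ω h) y i v :=
    ⟨_, (isLPRValue_iff r Ω hh y i _).2 rfl, fun v hv => (isLPRValue_iff r Ω hh y i v).1 hv⟩
  rw [lpr, dif_pos hex]
  exact (isLPRValue_iff r Ω hh y i _).1 hex.choose_spec.1

end Linear

/-! ### Polynomials on the grid -/

section Polynomials

variable {d n : ℕ}

/-- Evaluation of polynomials on the grid. -/
noncomputable def gridEval (d n : ℕ) : MvPolynomial (Fin d) ℝ →ₗ[ℝ] (Grid d n → ℝ) :=
  LinearMap.pi fun j => (MvPolynomial.aeval (pt j)).toLinearMap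

lemma gridEval_apply (p : MvPolynomial (Fin d) ℝ) (j : Grid d n) :
    gridEval d n p j = MvPolynomial.aeval (pt j) p := rfl

/-- Polynomials of degree at most `r`, as functions on the grid. -/
noncomputable def gridPoly (d n r : ℕ) : Submodule ℝ (Grid d n → ℝ) :=
  (MvPolynomial.restrictTotalDegree (Fin d) ℝ r).map (gridEval d n)

/-- The dimension of the space of polynomials of degree at most `r` in `d` variables. -/
noncomputable def polyDim (d r : ℕ) : ℕ :=
  Module.finrank ℝ (MvPolynomial.restrictTotalDegree (Fin d) ℝ r)

lemma finrank_gridPoly_le (d n r : ℕ) : Module.finrank ℝ (gridPoly d n r) ≤ polyDim d r :=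
  Submodule.finrank_map_le _ _

/-- Provides one space common to all centres, so that the pixels of a cell can share a single
projection. -/
lemma localPoly_le_gridPoly (r : ℕ) (i : Grid d n) : localPoly r i ≤ gridPoly d n r := by
  rintro _ ⟨a, rfl⟩
  refine ⟨∑ s : MultiIndex d r, MvPolynomial.C (a s) *
    ∏ k, (MvPolynomial.X k - MvPolynomial.C (pt i k)) ^ (s.1 k : ℕ), ?_, ?_⟩
  · refine Submodule.sum_mem _ fun s _ => ?_
    rw [MvPolynomial.mem_restrictTotalDegree]
    refine (MvPolynomial.totalDegree_mul _ _).trans ?_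
    rw [MvPolynomial.totalDegree_C, zero_add]
    refine (MvPolynomial.totalDegree_finsetProd _ _).trans (le_trans ?_ s.2)
    refine Finset.sum_le_sum fun k _ => ?_
    refine (MvPolynomial.totalDegree_pow _ _).trans ?_
    refine (Nat.mul_le_mul_left _ ((MvPolynomial.totalDegree_sub _ _).trans ?_)).trans
      (mul_one _).le
    simp
  · ext j
    rw [gridEval_apply, design_apply]
    simp

end Polynomials

/-! ### Windows -/

section Windows

variable {d n : ℕ}

/-- The bandwidth in units of pixels. -/
noncomputable def pixelRadius (n : ℕ) (h : ℝ) : ℕ := min ⌊n * h⌋₊ n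

lemma pt_sub_pt (i j : Grid d n) (k : Fin d) : pt i k - pt j k = ((i k : ℝ) - j k) / n := by
  simp only [pt]
  ring

/-- The cap at `n` in the pixel radius costs nothing, since indices differ by less than `n`. -/
lemma le_add_pixelRadius_of_mem_window {Ω : Set (Fin d → ℝ)} {h : ℝ} (hh : 0 < h)
    {i j : Grid d n} (hj : j ∈ window Ω h i) (k : Fin d) :
    (i k : ℕ) ≤ j k + pixelRadius n h ∧ (j k : ℕ) ≤ i k + pixelRadius n h := by
  have hn : 0 < (n : ℝ) := by exact_mod_cast (i k).pos
  have h1 := (pi_norm_le_iff_of_nonneg hh.le).1 (mem_window.1 hj).1 k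
  rw [Pi.sub_apply, pt_sub_pt, Real.norm_eq_abs, abs_div, abs_of_pos hn, div_le_iff₀ hn,
    abs_le] at h1
  have hi := (i k).2
  have hj' := (j k).2
  have h3 : ((i k : ℕ) : ℝ) - (j k : ℕ) ≤ ⌊(n : ℝ) * h⌋₊ := by
    have : (((i k : ℕ) - (j k : ℕ) : ℕ) : ℝ) ≤ ⌊(n : ℝ) * h⌋₊ := by
      refine Nat.cast_le.2 (Nat.le_floor ?_)
      rcases le_total (j k : ℕ) (i k : ℕ) with hl | hl
      · rw [Nat.cast_sub hl]; linarith
      · rw [Nat.sub_eq_zero_of_le hl]; push_cast; positivity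
    refine le_trans ?_ this
    rcases le_total (j k : ℕ) (i k : ℕ) with hl | hl
    · rw [Nat.cast_sub hl]
    · rw [Nat.sub_eq_zero_of_le hl]
      have : ((i k : ℕ) : ℝ) ≤ (j k : ℕ) := by exact_mod_cast hl
      push_cast; linarith
  have h4 : ((j k : ℕ) : ℝ) - (i k : ℕ) ≤ ⌊(n : ℝ) * h⌋₊ := by
    have : (((j k : ℕ) - (i k : ℕ) : ℕ) : ℝ) ≤ ⌊(n : ℝ) * h⌋₊ := by
      refine Nat.cast_le.2 (Nat.le_floor ?_)
      rcases le_total (i k : ℕ) (j k : ℕ) with hl | hl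
      · rw [Nat.cast_sub hl]; linarith
      · rw [Nat.sub_eq_zero_of_le hl]; push_cast; positivity
    refine le_trans ?_ this
    rcases le_total (i k : ℕ) (j k : ℕ) with hl | hl
    · rw [Nat.cast_sub hl]
    · rw [Nat.sub_eq_zero_of_le hl]
      have : ((j k : ℕ) : ℝ) ≤ (i k : ℕ) := by exact_mod_cast hl
      push_cast; linarith
  have h5 : (i k : ℕ) ≤ j k + ⌊(n : ℝ) * h⌋₊ := by
    have : ((i k : ℕ) : ℝ) ≤ ((j k : ℕ) + ⌊(n : ℝ) * h⌋₊ : ℕ) := by push_cast; linarith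
    exact_mod_cast this
  have h6 : (j k : ℕ) ≤ i k + ⌊(n : ℝ) * h⌋₊ := by
    have : ((j k : ℕ) : ℝ) ≤ ((i k : ℕ) + ⌊(n : ℝ) * h⌋₊ : ℕ) := by push_cast; linarith
    exact_mod_cast this
  unfold pixelRadius
  omega

lemma mem_window_of_div_eq {Ω : Set (Fin d → ℝ)} {h : ℝ} (hh : 0 < h) {i j : Grid d n}
    (ht : 1 ≤ pixelRadius n h)
    (hdiv : ∀ k, (i k : ℕ) / pixelRadius n h = (j k : ℕ) / pixelRadius n h)
    (hside : pt i ∈ Ω ↔ pt j ∈ Ω) : j ∈ window Ω h i := by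
  refine mem_window.2 ⟨(pi_norm_le_iff_of_nonneg hh.le).2 fun k => ?_, hside⟩
  have hn : 0 < (n : ℝ) := by exact_mod_cast (i k).pos
  set t := pixelRadius n h with ht'
  have hth : (t : ℝ) ≤ n * h := by
    refine le_trans ?_ (Nat.floor_le (by positivity : (0 : ℝ) ≤ n * h))
    exact_mod_cast min_le_left _ _
  rw [Pi.sub_apply, pt_sub_pt, Real.norm_eq_abs, abs_div, abs_of_pos hn, div_le_iff₀ hn,
    mul_comm h]
  refine le_trans ?_ hth
  have h1 := Nat.div_add_mod (i k : ℕ) t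
  have h2 := Nat.div_add_mod (j k : ℕ) t
  have h3 := Nat.mod_lt (i k : ℕ) ht
  have h4 := Nat.mod_lt (j k : ℕ) ht
  rw [hdiv k] at h1
  have h5 : (i k : ℕ) ≤ j k + t := by omega
  have h6 : (j k : ℕ) ≤ i k + t := by omega
  have h5' : ((i k : ℕ) : ℝ) ≤ (j k : ℕ) + t := by exact_mod_cast h5
  have h6' : ((j k : ℕ) : ℝ) ≤ (i k : ℕ) + t := by exact_mod_cast h6
  rw [abs_le]
  constructor <;> linarith

lemma card_le_prod_card (S : Finset (Grid d n)) (A : Fin d → Finset ℕ)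
    (hS : ∀ j ∈ S, ∀ k, (j k : ℕ) ∈ A k) : S.card ≤ ∏ k, (A k).card := by
  rw [← Fintype.card_piFinset]
  refine Finset.card_le_card_of_injOn (fun j k => (j k : ℕ))
    (fun j hj => Fintype.mem_piFinset.2 (hS j hj)) fun j _ j' _ he => ?_
  funext k
  exact Fin.ext (congrFun he k)

lemma card_window_le (Ω : Set (Fin d → ℝ)) {h : ℝ} (hh : 0 < h) (i : Grid d n) :
    (window Ω h i).card ≤ (2 * pixelRadius n h + 1) ^ d := by
  refine (card_le_prod_card _ (fun k => Finset.Icc (i k - pixelRadius n h : ℕ)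
    (i k + pixelRadius n h)) fun j hj k => ?_).trans ?_
  · have := le_add_pixelRadius_of_mem_window hh hj k
    rw [Finset.mem_Icc]
    omega
  · refine (Finset.prod_le_prod' (g := fun _ => 2 * pixelRadius n h + 1) fun k _ => ?_).trans
      (by simp)
    rw [Nat.card_Icc]
    omega

/-- A slab of width `l` meets only a small fraction of a window. -/
lemma card_window_inter_slab_le (Ω : Set (Fin d → ℝ)) {h : ℝ} (hh : 0 < h) (i : Grid d n)
    (k₀ : Fin d) {l : ℕ} (hl : 0 < l) (q : ℕ) :
    (window Ω h i ∩ Finset.univ.filter fun j => (j k₀ : ℕ) / l = q).card ≤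
      l * (2 * pixelRadius n h + 1) ^ (d - 1) := by
  refine (card_le_prod_card _ (Function.update (fun k => Finset.Icc (i k - pixelRadius n h : ℕ)
    (i k + pixelRadius n h)) k₀ (Finset.Ico (q * l) (q * l + l))) fun j hj k => ?_).trans ?_
  · rw [Finset.mem_inter, Finset.mem_filter] at hj
    by_cases hk : k = k₀
    · subst hk
      rw [Function.update_self, Finset.mem_Ico]
      have h1 := Nat.div_add_mod (j k : ℕ) l
      have h2 := Nat.mod_lt (j k : ℕ) hl
      rw [hj.2.2, mul_comm] at h1
      omega
    · rw [Function.update_of_ne hk]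
      have := le_add_pixelRadius_of_mem_window hh hj.1 k
      rw [Finset.mem_Icc]
      omega
  · rw [← Finset.mul_prod_erase _ _ (Finset.mem_univ k₀), Function.update_self, Nat.card_Ico]
    refine Nat.mul_le_mul (by omega) ?_
    refine (Finset.prod_le_prod' (g := fun _ => 2 * pixelRadius n h + 1) fun k hk => ?_).trans ?_
    · rw [Function.update_of_ne (Finset.ne_of_mem_erase hk), Nat.card_Icc]
      omega
    · rw [Finset.prod_const, Finset.card_erase_of_mem (Finset.mem_univ _), Finset.card_univ,
        Fintype.card_fin]

/-- The sum of the leverages of the membership oracle estimator. -/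
lemma sum_leverage_le (r : ℕ) (Ω : Set (Fin d → ℝ)) {h : ℝ} (hh : 0 < h)
    (ht : 1 ≤ pixelRadius n h) :
    ∑ i : Grid d n, hatWeight (localPoly r i) (window Ω h i) i i ≤
      2 * polyDim d r * (2 * n / pixelRadius n h : ℝ) ^ d := by
  classical
  set t := pixelRadius n h with ht'
  have htn : t ≤ n := min_le_right _ _
  -- The Boolean records the side of `Ω`, so that two pixels with the same label lie in each other's
  -- windows.
  let cell : Grid d n → (Fin d → Fin (n / t + 1)) × Bool := fun i =>
    (fun k => ⟨(i k : ℕ) / t, Nat.lt_succ_of_le (Nat.div_le_div_right (i k).2.le)⟩,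
      decide (pt i ∈ Ω))
  have hcell : ∀ c, ∑ i with cell i = c, hatWeight (localPoly r i) (window Ω h i) i i ≤
      polyDim d r := by
    intro c
    set Q : Finset (Grid d n) := Finset.univ.filter fun i => cell i = c with hQ
    have hsub : ∀ i ∈ Q, Q ⊆ window Ω h i := by
      intro i hi j hj
      have e : cell i = cell j := (Finset.mem_filter.1 hi).2.trans (Finset.mem_filter.1 hj).2.symm
      refine mem_window_of_div_eq hh ht (fun k => ?_) ?_
      · simpa [cell] using congrArg Fin.val (congrFun (congrArg Prod.fst e) k)
      · simpa [cell] using congrArg Prod.snd e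
    -- All windows shrink to the common set `Q` and all local models grow to the common polynomial
    -- space; what remains is one trace.
    calc ∑ i ∈ Q, hatWeight (localPoly r i) (window Ω h i) i i
        ≤ ∑ i ∈ Q, hatWeight (gridPoly d n r) Q i i := Finset.sum_le_sum fun i hi =>
          hatWeight_self_mono _ _ (localPoly_le_gridPoly r i) (hsub i hi) hi
      _ ≤ ∑ i, hatWeight (gridPoly d n r) Q i i := by
          refine Finset.sum_le_sum_of_subset_of_nonneg (Finset.subset_univ _) fun i _ hi => ?_
          rw [hatWeight_eq_zero _ _ hi]
      _ ≤ Module.finrank ℝ (gridPoly d n r) := sum_hatWeight_self_le _ _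
      _ ≤ polyDim d r := by exact_mod_cast finrank_gridPoly_le d n r
  rw [← Finset.sum_fiberwise (s := Finset.univ) (g := cell)]
  refine (Finset.sum_le_card_nsmul _ _ _ fun c _ => hcell c).trans ?_
  have hcard : ((Finset.univ : Finset ((Fin d → Fin (n / t + 1)) × Bool)).card : ℝ) ≤
      2 * (2 * n / t : ℝ) ^ d := by
    have ht0 : (0 : ℝ) < t := by exact_mod_cast ht
    have h1 : ((n / t + 1 : ℕ) : ℝ) ≤ 2 * n / t := by
      push_cast
      have h2 : ((n / t : ℕ) : ℝ) ≤ (n : ℝ) / t := Nat.cast_div_le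
      have h3 : (1 : ℝ) ≤ (n : ℝ) / t := (one_le_div ht0).2 (by exact_mod_cast htn)
      rw [mul_div_assoc]
      linarith
    simp only [Finset.card_univ, Fintype.card_prod, Fintype.card_pi, Fintype.card_fin,
      Finset.prod_const, Fintype.card_bool, Nat.cast_mul, Nat.cast_pow, Nat.cast_ofNat]
    rw [mul_comm]
    gcongr
  rw [nsmul_eq_mul]
  calc _ ≤ 2 * (2 * n / t : ℝ) ^ d * polyDim d r := by gcongr
    _ = _ := by ring

end Windows

/-! ### Taylor approximation -/

section Taylor

lemma holderOrder_lt {α : ℝ} (hα : 0 < α) : (holderOrder α : ℝ) < α := by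
  have h1 : 1 ≤ ⌈α⌉₊ := Nat.one_le_ceil_iff.2 hα
  have h2 := Nat.ceil_lt_add_one hα.le
  rw [holderOrder, Nat.cast_sub h1]
  push_cast
  linarith

lemma le_holderOrder_add_one {α : ℝ} (hα : 0 < α) : α ≤ holderOrder α + 1 := by
  have h1 : 1 ≤ ⌈α⌉₊ := Nat.one_le_ceil_iff.2 hα
  have h2 := Nat.le_ceil α
  rw [holderOrder, Nat.cast_sub h1]
  push_cast
  linarith

/-- Taylor's theorem for a chain of derivatives on `[0,1]`. -/
lemma abs_sub_taylor_le (l : ℕ) : ∀ (φ : ℕ → ℝ → ℝ) (M : ℝ),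
    (∀ k < l, ∀ t ∈ Set.Icc (0 : ℝ) 1,
      HasDerivWithinAt (φ k) (φ (k + 1) t) (Set.Icc 0 1) t) →
    (∀ t ∈ Set.Icc (0 : ℝ) 1, |φ l t - φ l 0| ≤ M) →
    ∀ t ∈ Set.Icc (0 : ℝ) 1,
      |φ 0 t - ∑ k ∈ Finset.range (l + 1), φ k 0 * (t ^ k / k.factorial)| ≤ M := by
  induction l with
  | zero =>
    intro φ M _ hM t ht
    simpa using hM t ht
  | succ l ih =>
    intro φ M hφ hM t ht
    have hM0 : 0 ≤ M := (abs_nonneg _).trans (hM t ht)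
    set ψ : ℝ → ℝ := fun t =>
      φ 0 t - ∑ k ∈ Finset.range (l + 1 + 1), φ k 0 * (t ^ k / k.factorial) with hψ
    -- The derivative of the remainder is the remainder of the shifted chain. The induction
    -- hypothesis bounds it, and the mean value inequality bounds the remainder itself.
    have hd : ∀ s ∈ Set.Icc (0 : ℝ) 1, HasDerivWithinAt ψ
        (φ 1 s - ∑ k ∈ Finset.range (l + 1), φ (k + 1) 0 * (s ^ k / k.factorial))
        (Set.Icc 0 1) s := by
      intro s hs
      refine (hφ 0 (Nat.succ_pos _) s hs).sub ?_
      have h1 : HasDerivWithinAt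
          (fun t => ∑ k ∈ Finset.range (l + 1 + 1), φ k 0 * (t ^ k / k.factorial))
          (∑ k ∈ Finset.range (l + 1 + 1), φ k 0 * ((k * s ^ (k - 1)) / k.factorial))
          (Set.Icc 0 1) s := by
        refine HasDerivWithinAt.fun_sum fun k _ => ?_
        exact (((hasDerivAt_pow k s).div_const _).const_mul _).hasDerivWithinAt
      refine h1.congr_deriv ?_
      rw [Finset.sum_range_succ' _ (l + 1)]
      simp only [Nat.cast_zero, zero_mul, zero_div, mul_zero, add_zero]
      refine Finset.sum_congr rfl fun k _ => ?_
      rw [Nat.factorial_succ, Nat.add_sub_cancel]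
      push_cast
      field_simp
    have hb : ∀ s ∈ Set.Icc (0 : ℝ) 1,
        ‖φ 1 s - ∑ k ∈ Finset.range (l + 1), φ (k + 1) 0 * (s ^ k / k.factorial)‖ ≤ M :=
      fun s hs => ih (fun k => φ (k + 1)) M (fun k hk s hs => hφ (k + 1) (by omega) s hs) hM s hs
    have h := (convex_Icc (0 : ℝ) 1).norm_image_sub_le_of_norm_hasDerivWithin_le hd hb
      (Set.left_mem_Icc.2 zero_le_one) ht
    have h0 : ψ 0 = 0 := by
      simp only [hψ]
      rw [Finset.sum_range_succ' _ (l + 1)]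
      simp
    rw [h0, sub_zero, sub_zero, Real.norm_eq_abs, Real.norm_eq_abs, abs_of_nonneg ht.1] at h
    exact h.trans (mul_le_of_le_one_right hM0 ht.2)

variable {d : ℕ}

lemma convex_cube : Convex ℝ (cube d) := convex_Icc _ _

lemma uniqueDiffOn_cube : UniqueDiffOn ℝ (cube d) := by
  rw [cube, ← Set.pi_univ_Icc]
  exact UniqueDiffOn.univ_pi fun _ => uniqueDiffOn_Icc_zero_one

lemma iteratedFDerivWithin_eq_sum_partialDeriv (g : (Fin d → ℝ) → ℝ) (k : ℕ) (x v : Fin d → ℝ) :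
    iteratedFDerivWithin ℝ k g (cube d) x (fun _ => v) =
      ∑ c : Fin k → Fin d, partialDeriv c g x * ∏ m, v (c m) := by
  have hv : v = ∑ j, v j • Pi.single (M := fun _ => ℝ) j 1 := by
    ext j
    simp [Finset.sum_apply, Pi.single_apply]
  conv_lhs => rw [hv]
  rw [ContinuousMultilinearMap.map_sum]
  refine Finset.sum_congr rfl fun c _ => ?_
  rw [ContinuousMultilinearMap.map_smul_univ, partialDeriv, smul_eq_mul, mul_comm]

/-- Polynomials of degree at most `r`, spanned by the monomials centred at `x`. -/
noncomputable def polyAt (r : ℕ) (x : Fin d → ℝ) :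
    (MultiIndex d r → ℝ) →ₗ[ℝ] ((Fin d → ℝ) → ℝ) where
  toFun a z := ∑ s, a s * ∏ k, (z k - x k) ^ (s.1 k : ℕ)
  map_add' a b := by
    ext j
    simp [add_mul, Finset.sum_add_distrib]
  map_smul' c a := by
    ext j
    simp [Finset.mul_sum, mul_assoc]

lemma polyAt_apply (r : ℕ) (x z : Fin d → ℝ) (a : MultiIndex d r → ℝ) :
    polyAt r x a z = ∑ s, a s * ∏ k, (z k - x k) ^ (s.1 k : ℕ) := rfl

/-- A sequence of directions gives the monomial whose exponents count how often each direction
occurs. -/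
lemma prod_sub_mem_range_polyAt {r k : ℕ} (hk : k ≤ r) (x : Fin d → ℝ) (c : Fin k → Fin d) :
    (fun z => ∏ m, (z (c m) - x (c m))) ∈ LinearMap.range (polyAt r x) := by
  classical
  have hsum : ∑ j, (Finset.univ.filter fun m => c m = j).card = k := by
    rw [← Finset.card_eq_sum_card_fiberwise (s := Finset.univ) (t := Finset.univ)
      (fun _ _ => Finset.mem_coe.2 (Finset.mem_univ _)), Finset.card_univ, Fintype.card_fin]
  let s : MultiIndex d r := ⟨fun j => ⟨(Finset.univ.filter fun m => c m = j).card, by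
    have := Finset.card_le_univ (Finset.univ.filter fun m => c m = j)
    rw [Fintype.card_fin] at this
    omega⟩, by
    simpa using hsum.le.trans hk⟩
  refine ⟨Pi.single s 1, ?_⟩
  ext z
  rw [polyAt_apply, Finset.sum_eq_single s]
  · rw [Pi.single_eq_same, one_mul, ← Finset.prod_fiberwise' Finset.univ c
      (fun j => z j - x j)]
    refine Finset.prod_congr rfl fun j _ => ?_
    rw [Finset.prod_const]
  · intro b _ hb
    rw [Pi.single_eq_of_ne hb, zero_mul]
  · simp

lemma hasDerivWithinAt_iteratedFDerivWithin_segment {g : (Fin d → ℝ) → ℝ} {l k : ℕ}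
    (hg : ContDiffOn ℝ l g (cube d)) (hk : k < l) {x z : Fin d → ℝ} (hx : x ∈ cube d)
    (hz : z ∈ cube d) {t : ℝ} (ht : t ∈ Set.Icc (0 : ℝ) 1) :
    HasDerivWithinAt
      (fun t : ℝ => iteratedFDerivWithin ℝ k g (cube d) (x + t • (z - x)) (fun _ => z - x))
      (iteratedFDerivWithin ℝ (k + 1) g (cube d) (x + t • (z - x)) (fun _ => z - x))
      (Set.Icc 0 1) t := by
  have hmaps : Set.MapsTo (fun t : ℝ => x + t • (z - x)) (Set.Icc 0 1) (cube d) :=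
    fun s hs => convex_cube.add_smul_sub_mem hx hz hs
  have h1 : HasDerivWithinAt (fun t : ℝ => x + t • (z - x)) (z - x) (Set.Icc 0 1) t := by
    simpa using (((hasDerivAt_id t).smul_const (z - x)).const_add x).hasDerivWithinAt
  have h2 := ((hg.differentiableOn_iteratedFDerivWithin (by exact_mod_cast hk)
    uniqueDiffOn_cube) _ (hmaps ht)).hasFDerivWithinAt
  have h3 := h2.comp_hasDerivWithinAt t h1 hmaps
  have h4 := (ContinuousMultilinearMap.apply ℝ (fun _ : Fin k => Fin d → ℝ) ℝ
    (fun _ => z - x)).hasFDerivAt.comp_hasDerivWithinAt t h3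
  rw [iteratedFDerivWithin_succ_apply_left]
  exact h4

/-- The Taylor polynomial of a Hölder function. -/
lemma IsHolder.exists_taylor {α C₀ : ℝ} {g : (Fin d → ℝ) → ℝ} (hα : 0 < α) (hC₀ : 0 ≤ C₀)
    (hg : IsHolder d α C₀ g) {r : ℕ} (hr : holderOrder α ≤ r) {x : Fin d → ℝ}
    (hx : x ∈ cube d) :
    ∃ a : MultiIndex d r → ℝ, polyAt r x a x = g x ∧
      ∀ z ∈ cube d, |g z - polyAt r x a z| ≤ C₀ * d ^ holderOrder α * ‖z - x‖ ^ α := by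
  set l := holderOrder α with hl
  let T : (Fin d → ℝ) → ℝ := fun z => ∑ k ∈ Finset.range (l + 1),
    iteratedFDerivWithin ℝ k g (cube d) x (fun _ => z - x) * (1 ^ k / k.factorial)
  have hT : T ∈ LinearMap.range (polyAt r x) := by
    have : T = ∑ k ∈ Finset.range (l + 1), ∑ c : Fin k → Fin d,
        ((1 ^ k / k.factorial) * partialDeriv c g x) • fun z => ∏ m, (z (c m) - x (c m)) := by
      ext z
      simp only [T, Finset.sum_apply, Pi.smul_apply, smul_eq_mul]
      refine Finset.sum_congr rfl fun k _ => ?_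
      rw [iteratedFDerivWithin_eq_sum_partialDeriv, Finset.sum_mul]
      refine Finset.sum_congr rfl fun c _ => ?_
      simp only [Pi.sub_apply]
      ring
    rw [this]
    refine Submodule.sum_mem _ fun k hk => Submodule.sum_mem _ fun c _ =>
      Submodule.smul_mem _ _ (prod_sub_mem_range_polyAt ?_ x c)
    have := Finset.mem_range.1 hk
    omega
  obtain ⟨a, ha⟩ := hT
  refine ⟨a, ?_, fun z hz => ?_⟩
  · rw [ha]
    simp only [T]
    rw [Finset.sum_range_succ' _ l, Finset.sum_eq_zero]
    · simp
    · intro k _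
      rw [sub_self]
      rw [ContinuousMultilinearMap.map_coord_zero _ (0 : Fin (k + 1)) rfl, zero_mul]
  · rw [ha]
    have hlα := holderOrder_lt hα
    rw [← hl] at hlα
    -- Taylor on the segment from `x` to `z`. The `l`-th directional derivative is a sum over `d ^
    -- l` sequences of directions; each changes by at most `C₀ ‖z - x‖ ^ (α - l)` times a product of
    -- size `‖z - x‖ ^ l`.
    have h1 := abs_sub_taylor_le l
      (fun k t => iteratedFDerivWithin ℝ k g (cube d) (x + t • (z - x)) (fun _ => z - x))
      (C₀ * d ^ l * ‖z - x‖ ^ α)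
      (fun k hk t ht => hasDerivWithinAt_iteratedFDerivWithin_segment hg.contDiffOn hk hx hz ht)
      (fun t ht => ?_) 1 (Set.right_mem_Icc.2 zero_le_one)
    · simpa [T] using h1
    · have hxt : x + t • (z - x) ∈ cube d := convex_cube.add_smul_sub_mem hx hz ht
      simp only [zero_smul, add_zero]
      rw [iteratedFDerivWithin_eq_sum_partialDeriv, iteratedFDerivWithin_eq_sum_partialDeriv,
        ← Finset.sum_sub_distrib]
      refine (Finset.abs_sum_le_sum_abs _ _).trans ?_
      have hterm : ∀ c : Fin l → Fin d, |partialDeriv c g (x + t • (z - x)) * ∏ m, (z - x) (c m) -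
          partialDeriv c g x * ∏ m, (z - x) (c m)| ≤ C₀ * ‖z - x‖ ^ α := by
        intro c
        rw [← sub_mul, abs_mul, Finset.abs_prod]
        have h2 := hg.holder _ hxt x hx c
        have h3 : ‖x + t • (z - x) - x‖ ≤ ‖z - x‖ := by
          rw [add_sub_cancel_left, norm_smul, Real.norm_eq_abs, abs_of_nonneg ht.1]
          exact mul_le_of_le_one_left (norm_nonneg _) ht.2
        have h4 : ∏ m, |(z - x) (c m)| ≤ ‖z - x‖ ^ l := by
          refine (Finset.prod_le_prod (fun _ _ => abs_nonneg _)
            fun m _ => norm_le_pi_norm (z - x) (c m)).trans ?_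
          simp
        calc _ ≤ (C₀ * ‖z - x‖ ^ (α - l)) * ‖z - x‖ ^ l := by
              refine mul_le_mul (h2.trans ?_) h4 (Finset.prod_nonneg fun _ _ => abs_nonneg _)
                (by positivity)
              gcongr
          _ = C₀ * ‖z - x‖ ^ α := by
              rw [mul_assoc, ← Real.rpow_natCast, ← Real.rpow_add_of_nonneg (norm_nonneg _)
                (by linarith) (Nat.cast_nonneg _), sub_add_cancel]
      refine (Finset.sum_le_card_nsmul _ _ _ fun c _ => hterm c).trans ?_
      simp only [Finset.card_univ, Fintype.card_pi, Fintype.card_fin, Finset.prod_const,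
        nsmul_eq_mul, Nat.cast_pow]
      apply le_of_eq
      ring

end Taylor

/-! ### Upper bound -/

section Upper

variable {d n : ℕ}

/-- Weights of the membership oracle estimator. -/
noncomputable def fitWeight (r : ℕ) (Ω : Set (Fin d → ℝ)) (h : ℝ) (i j : Grid d n) : ℝ :=
  hatWeight (localPoly r i) (window Ω h i) i j

lemma sum_fitWeight_sq (r : ℕ) (Ω : Set (Fin d → ℝ)) {h : ℝ} (hh : 0 < h) (i : Grid d n) :
    ∑ j, fitWeight r Ω h i j ^ 2 = fitWeight r Ω h i i :=
  sum_hatWeight_sq _ _ (self_mem_window Ω hh i)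

lemma fitWeight_self_nonneg (r : ℕ) (Ω : Set (Fin d → ℝ)) {h : ℝ} (hh : 0 < h) (i : Grid d n) :
    0 ≤ fitWeight r Ω h i i :=
  hatWeight_self_nonneg _ _ (self_mem_window Ω hh i)

lemma measurable_sum_mul (w : Grid d n → ℝ) :
    Measurable fun ε : Grid d n → ℝ => ∑ j, w j * ε j := by
  fun_prop

lemma integrable_affine_sq {P : Measure (Grid d n → ℝ)} [IsProbabilityMeasure P]
    (hP : ∀ i, MemLp (fun ε => ε i) 2 P) (b : ℝ) (w : Grid d n → ℝ) :
    Integrable (fun ε => (b + ∑ j, w j * ε j) ^ 2) P := by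
  have h : MemLp (fun ε : Grid d n → ℝ => b + ∑ j, w j * ε j) 2 P :=
    (memLp_const b).add (memLp_finsetSum _ fun j _ => (hP j).const_mul (w j))
  exact h.integrable_sq

/-- The bias-variance decomposition: the cross terms vanish because the noise is centred and
uncorrelated. -/
lemma integral_affine_sq {σ : ℝ} {P : Measure (Grid d n → ℝ)} (hP : P ∈ whiteNoise d n σ)
    (b : ℝ) (w : Grid d n → ℝ) :
    ∫ ε, (b + ∑ j, w j * ε j) ^ 2 ∂P = b ^ 2 + σ ^ 2 * ∑ j, w j ^ 2 := by
  obtain ⟨hprob, hL2, hmean, hcov⟩ := hP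
  have hint : ∀ j, Integrable (fun ε : Grid d n → ℝ => ε j) P := fun j =>
    (hL2 j).integrable (by norm_num)
  have hint2 : ∀ j k, Integrable (fun ε : Grid d n → ℝ => ε j * ε k) P := fun j k =>
    (hL2 j).integrable_mul (hL2 k)
  have e : ∀ ε : Grid d n → ℝ, (b + ∑ j, w j * ε j) ^ 2 =
      b ^ 2 + 2 * b * (∑ j, w j * ε j) + ∑ j, ∑ k, w j * w k * (ε j * ε k) := by
    intro ε
    have : (∑ j, w j * ε j) ^ 2 = ∑ j, ∑ k, w j * w k * (ε j * ε k) := by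
      rw [sq, Finset.sum_mul_sum]
      exact Finset.sum_congr rfl fun j _ => Finset.sum_congr rfl fun k _ => by ring
    rw [← this]
    ring
  have i1 : Integrable (fun ε : Grid d n → ℝ => ∑ j, w j * ε j) P :=
    integrable_finsetSum _ fun j _ => (hint j).const_mul _
  have i2 : Integrable (fun ε : Grid d n → ℝ => ∑ j, ∑ k, w j * w k * (ε j * ε k)) P :=
    integrable_finsetSum _ fun j _ => integrable_finsetSum _ fun k _ => (hint2 j k).const_mul _
  have i3 : Integrable (fun ε : Grid d n → ℝ => b ^ 2 + 2 * b * ∑ j, w j * ε j) P :=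
    (integrable_const _).add (i1.const_mul _)
  simp_rw [e]
  rw [integral_add i3 i2, integral_add (integrable_const _) (i1.const_mul _), integral_const_mul,
    integral_finsetSum _ fun j _ => (hint j).const_mul _,
    integral_finsetSum _ fun j _ => integrable_finsetSum _ fun k _ => (hint2 j k).const_mul _]
  have h1 : ∀ j, ∫ ε, w j * ε j ∂P = 0 := fun j => by rw [integral_const_mul, hmean, mul_zero]
  have h2 : ∀ j, ∫ ε, ∑ k, w j * w k * (ε j * ε k) ∂P = σ ^ 2 * w j ^ 2 := by
    intro j
    rw [integral_finsetSum _ fun k _ => (hint2 j k).const_mul _, Finset.sum_eq_single j]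
    · rw [integral_const_mul, hcov, if_pos rfl]
      ring
    · intro k _ hk
      rw [integral_const_mul, hcov, if_neg hk.symm, mul_zero]
    · simp
  simp [h1, h2, Finset.mul_sum]

lemma lintegral_affine_sq {σ : ℝ} {P : Measure (Grid d n → ℝ)} (hP : P ∈ whiteNoise d n σ)
    (b : ℝ) (w : Grid d n → ℝ) :
    ∫⁻ ε, ENNReal.ofReal ((b + ∑ j, w j * ε j) ^ 2) ∂P =
      ENNReal.ofReal (b ^ 2 + σ ^ 2 * ∑ j, w j ^ 2) := by
  have := hP.1
  rw [← integral_affine_sq hP b w, ofReal_integral_eq_lintegral_ofReal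
    (integrable_affine_sq hP.2.1 b w) (Filter.Eventually.of_forall fun _ => sq_nonneg _)]

/-- Truncation to `[0,1]` if `clip = true`. -/
noncomputable def truncate (clip : Bool) (z : ℝ) : ℝ := if clip then max 0 (min 1 z) else z

lemma moEstimator_eq (clip : Bool) (r : ℕ) (Ω : Set (Fin d → ℝ)) {h : ℝ} (hh : 0 < h)
    (y : Grid d n → ℝ) (i : Grid d n) :
    moEstimator clip r Ω h y i = truncate clip (∑ j, fitWeight r Ω h i j * y j) := by
  rw [moEstimator, lpr_eq_sum r Ω hh]
  rfl

/-- Truncation does not increase distances and fixes `m`. -/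
lemma sq_truncate_sub_le (clip : Bool) (z : ℝ) {m : ℝ} (hm : m ∈ Set.Icc (0 : ℝ) 1) :
    (truncate clip z - m) ^ 2 ≤ (z - m) ^ 2 := by
  obtain ⟨h0, h1⟩ := hm
  rw [sq_le_sq]
  cases clip
  · simp [truncate]
  · simp only [truncate, if_true]
    rcases le_total z 0 with hz | hz
    · rw [min_eq_right (by linarith), max_eq_left hz, abs_le]
      constructor
      · rw [abs_of_nonpos (by linarith)]; linarith
      · rw [abs_of_nonpos (by linarith)]; linarith
    · rcases le_total 1 z with hz1 | hz1
      · rw [min_eq_left hz1, max_eq_right zero_le_one, abs_of_nonneg (by linarith),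
          abs_of_nonneg (by linarith)]
        linarith
      · rw [min_eq_right hz1, max_eq_right hz]

lemma pt_mem_cube (i : Grid d n) : pt i ∈ cube d := by
  have hb : ∀ k, 0 ≤ pt i k ∧ pt i k ≤ 1 := by
    intro k
    have hn : 0 < (n : ℝ) := by exact_mod_cast (i k).pos
    have h1 : ((i k : ℕ) : ℝ) + 1 ≤ n := by exact_mod_cast (i k).2
    have h2 : (0 : ℝ) ≤ (i k : ℕ) := Nat.cast_nonneg _
    rw [pt]
    exact ⟨by positivity, (div_le_one hn).2 (by linarith)⟩
  exact ⟨fun k => (hb k).1, fun k => (hb k).2⟩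

variable {α C₀ : ℝ}

lemma CartoonImage.toFun_eq_fg (F : CartoonImage d α C₀) {x : Fin d → ℝ} (hx : x ∈ F.Ω) :
    F.toFun x = F.fg x := by
  simp [CartoonImage.toFun, hx]

lemma CartoonImage.toFun_eq_bg (F : CartoonImage d α C₀) {x : Fin d → ℝ} (hx : x ∉ F.Ω) :
    F.toFun x = F.bg x := by
  simp [CartoonImage.toFun, hx]

lemma CartoonImage.toFun_mem_Icc (F : CartoonImage d α C₀) {x : Fin d → ℝ} (hx : x ∈ cube d) :
    F.toFun x ∈ Set.Icc (0 : ℝ) 1 := by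
  by_cases h : x ∈ F.Ω
  · rw [F.toFun_eq_fg h]; exact F.holder_fg.mem_Icc x hx
  · rw [F.toFun_eq_bg h]; exact F.holder_bg.mem_Icc x hx

/-- The bias of the membership oracle estimator. -/
lemma CartoonImage.sq_bias_le (F : CartoonImage d α C₀) (hα : 0 < α) (hC₀ : 0 ≤ C₀) {r : ℕ}
    (hr : holderOrder α ≤ r) {h : ℝ} (hh : 0 < h) (i : Grid d n) :
    ((∑ j, fitWeight r F.Ω h i j * F.toFun (pt j)) - F.toFun (pt i)) ^ 2 ≤
      (C₀ * d ^ holderOrder α * h ^ α) ^ 2 * (window F.Ω h i).card * fitWeight r F.Ω h i i := by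
  have hi := self_mem_window F.Ω hh i
  obtain ⟨g, hg, hgF⟩ : ∃ g, IsHolder d α C₀ g ∧
      ∀ j ∈ window F.Ω h i, F.toFun (pt j) = g (pt j) := by
    by_cases hΩ : pt i ∈ F.Ω
    · exact ⟨F.fg, F.holder_fg, fun j hj => F.toFun_eq_fg ((mem_window.1 hj).2.1 hΩ)⟩
    · exact ⟨F.bg, F.holder_bg, fun j hj => F.toFun_eq_bg fun hc => hΩ ((mem_window.1 hj).2.2 hc)⟩
  obtain ⟨a, ha, hT⟩ := hg.exists_taylor hα hC₀ hr (pt_mem_cube i)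
  -- The fit reproduces the Taylor polynomial at its own pixel, so the bias is the weights applied
  -- to the Taylor remainder.
  have h1 : F.toFun (pt i) = ∑ j, fitWeight r F.Ω h i j * design r i a j := by
    rw [hgF i hi, ← ha]
    exact (sum_hatWeight_mul_mem (localPoly r i) _ hi ⟨a, rfl⟩).symm
  rw [h1, ← Finset.sum_sub_distrib]
  simp_rw [← mul_sub]
  refine (sq_sum_hatWeight_mul_le (localPoly r i) (window F.Ω h i) hi (window F.Ω h i)
    (fun j hj hj' => absurd hj hj') (B := (C₀ * d ^ holderOrder α * h ^ α) ^ 2)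
    fun j hj => ?_).trans (by rw [Finset.inter_self]; rfl)
  rw [hgF j hj]
  refine sq_le_sq' ?_ ?_
  all_goals
    have h2 := hT (pt j) (pt_mem_cube j)
    have h3 : ‖pt j - pt i‖ ^ α ≤ h ^ α := by
      rw [norm_sub_rev]
      exact Real.rpow_le_rpow (norm_nonneg _) (mem_window.1 hj).1 hα.le
    have h4 : C₀ * d ^ holderOrder α * ‖pt j - pt i‖ ^ α ≤ C₀ * d ^ holderOrder α * h ^ α := by
      gcongr
    have h5 := abs_le.1 (h2.trans h4)
    have h6 : design r i a j = polyAt r (pt i) a (pt j) := rfl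
    rw [h6]
    first | exact h5.1 | exact h5.2

lemma mse_moEstimator_le (F : CartoonImage d α C₀) {σ : ℝ} {P : Measure (Grid d n → ℝ)}
    (hP : P ∈ whiteNoise d n σ) (clip : Bool) (r : ℕ) {h : ℝ} (hh : 0 < h) :
    mse P (moEstimator clip r F.Ω h) F.toFun ≤
      (∑ i : Grid d n, ENNReal.ofReal
        (((∑ j, fitWeight r F.Ω h i j * F.toFun (pt j)) - F.toFun (pt i)) ^ 2 +
          σ ^ 2 * fitWeight r F.Ω h i i)) / (n : ℝ≥0∞) ^ d := by
  unfold mse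
  gcongr with i
  rw [← sum_fitWeight_sq r F.Ω hh i, ← lintegral_affine_sq hP]
  refine lintegral_mono fun ε => ENNReal.ofReal_le_ofReal ?_
  rw [moEstimator_eq clip r F.Ω hh]
  refine (sq_truncate_sub_le clip _ (F.toFun_mem_Icc (pt_mem_cube i))).trans (le_of_eq ?_)
  simp only [mul_add, Finset.sum_add_distrib]
  ring

/-- Bias and variance are both proportional to the leverage. The bound `S` stays free because it is
`n ^ d` for bandwidths below the pixel spacing and comes from `sum_leverage_le` otherwise. -/
lemma moRisk_le (hα : 0 < α) (hC₀ : 0 ≤ C₀) {r : ℕ} (hr : holderOrder α ≤ r) (hn : 1 ≤ n)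
    {σ : ℝ} {P : Measure (Grid d n → ℝ)}
    (hP : P ∈ whiteNoise d n σ) (clip : Bool) {h : ℝ} (hh : 0 < h) {S : ℝ}
    (hS : ∀ Ω : Set (Fin d → ℝ), ∑ i : Grid d n, fitWeight r Ω h i i ≤ S) :
    moRisk clip r α C₀ P h ≤ ENNReal.ofReal
      (((C₀ * d ^ holderOrder α * h ^ α) ^ 2 * (2 * pixelRadius n h + 1) ^ d + σ ^ 2) * S
        / n ^ d) := by
  refine iSup_le fun F => (mse_moEstimator_le F hP clip r hh).trans ?_
  have hn' : (0 : ℝ) < n := by exact_mod_cast hn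
  rw [ENNReal.ofReal_div_of_pos (by positivity), ENNReal.ofReal_pow (Nat.cast_nonneg _),
    ENNReal.ofReal_natCast, ← ENNReal.ofReal_sum_of_nonneg fun i _ => add_nonneg (sq_nonneg _)
      (mul_nonneg (sq_nonneg _) (fitWeight_self_nonneg r F.Ω hh i))]
  gcongr
  refine le_trans ?_ (mul_le_mul_of_nonneg_left (hS F.Ω) (by positivity))
  rw [Finset.mul_sum]
  refine Finset.sum_le_sum fun i _ => ?_
  have h1 := F.sq_bias_le hα hC₀ hr hh i
  have h2 := fitWeight_self_nonneg r F.Ω hh i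
  have h3 : ((window F.Ω h i).card : ℝ) ≤ (2 * pixelRadius n h + 1) ^ d := by
    exact_mod_cast card_window_le F.Ω hh i
  rw [add_mul]
  gcongr
  refine h1.trans ?_
  gcongr

lemma hMO_pos {σ : ℝ} (hn : 1 ≤ n) (hσ : 0 < σ) : 0 < hMO d n α σ := by
  have hn' : (0 : ℝ) < n := by exact_mod_cast hn
  unfold hMO
  positivity

lemma rateMO_eq {σ : ℝ} (hn : 1 ≤ n) : rateMO d n α σ = hMO d n α σ ^ (2 * α) := by
  have hn' : (0 : ℝ) < n := by exact_mod_cast hn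
  rw [rateMO, hMO, ← Real.rpow_mul (by positivity)]
  congr 1
  ring

/-- The balance that defines `hMO`: there the variance `σ² / (n h)^d` equals the squared bias `h ^
(2α)`, which is the rate. -/
lemma sq_eq_hMO {σ : ℝ} (hα : 0 < α) (hn : 1 ≤ n) (hσ : 0 < σ) :
    σ ^ 2 = (n * hMO d n α σ) ^ d * rateMO d n α σ := by
  have hn' : (0 : ℝ) < n := by exact_mod_cast hn
  have hH := hMO_pos (d := d) (α := α) hn hσ
  rw [rateMO_eq hn, mul_pow, mul_assoc, ← Real.rpow_natCast (hMO d n α σ) d,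
    ← Real.rpow_add hH, hMO, ← Real.rpow_mul (by positivity),
    one_div_mul_cancel (by positivity), Real.rpow_one]
  field_simp

/-- Every bandwidth of order `hMO` attains the rate. -/
lemma exists_moRisk_le_rateMO (d r : ℕ) (hα : 0 < α) (hC₀ : 0 ≤ C₀) (hr : holderOrder α ≤ r)
    {a b : ℝ} (ha : 0 < a) (hab : a ≤ b) :
    ∃ C : ℝ, 0 < C ∧ ∀ (n : ℕ) (σ : ℝ), 1 ≤ n → 0 < σ → hMO d n α σ ≤ 1 →
      ∀ (clip : Bool), ∀ P ∈ whiteNoise d n σ,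
        ∀ h : ℝ, a * hMO d n α σ ≤ h → h ≤ b * hMO d n α σ →
          moRisk clip r α C₀ P h ≤ ENNReal.ofReal (C * rateMO d n α σ) := by
  have hb : 0 < b := ha.trans_le hab
  set C₁ : ℝ := C₀ * d ^ holderOrder α with hC₁
  set D : ℝ := 2 * polyDim d r * 2 ^ d with hD
  have hD0 : 0 ≤ D := by positivity
  refine ⟨(C₁ ^ 2 * b ^ (2 * α) + a⁻¹ ^ d) +
    (C₁ ^ 2 * b ^ (2 * α) * 3 ^ d * D + D * (2 / a + 1) ^ d), by positivity, ?_⟩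
  intro n σ hn hσ hH1 clip P hP h hah hhb
  have hH := hMO_pos (d := d) (α := α) hn hσ
  have hR := rateMO_eq (d := d) (α := α) (σ := σ) hn
  have hσ2 := sq_eq_hMO (d := d) hα hn hσ
  set H := hMO d n α σ
  set R := rateMO d n α σ
  have hR0 : 0 ≤ R := hR ▸ Real.rpow_nonneg hH.le _
  have hh : 0 < h := (mul_pos ha hH).trans_le hah
  have hn' : (0 : ℝ) < n := by exact_mod_cast hn
  have hhR : (h ^ α) ^ 2 ≤ b ^ (2 * α) * R := by
    rw [hR, ← Real.mul_rpow hb.le hH.le, ← Real.rpow_natCast, ← Real.rpow_mul hh.le]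
    calc h ^ (α * (2 : ℕ)) = h ^ (2 * α) := by push_cast; ring_nf
      _ ≤ _ := Real.rpow_le_rpow hh.le hhb (by positivity)
  set t := pixelRadius n h with ht
  -- If `n h < 1`, leverages are bounded by one; then `n H < 1 / a` as well, so `σ²` is already of
  -- the order of the rate.
  rcases Nat.eq_zero_or_pos t with h0 | h1
  · have hnh : n * h < 1 := by
      rcases min_eq_iff.1 (ht.symm.trans h0) with hc | hc
      · exact Nat.floor_eq_zero.1 hc.1
      · omega
    refine (moRisk_le hα hC₀ hr hn hP clip hh (S := n ^ d) fun Ω => ?_).trans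
      (ENNReal.ofReal_le_ofReal ?_)
    · refine (Finset.sum_le_card_nsmul _ _ 1 fun i _ =>
        hatWeight_self_le_one _ _ (self_mem_window Ω hh i)).trans ?_
      simp
    · rw [← ht, h0, mul_div_assoc, div_self (by positivity), mul_one]
      have h2 : σ ^ 2 ≤ a⁻¹ ^ d * R := by
        rw [hσ2]
        gcongr
        rw [← one_div, le_div_iff₀ ha]
        nlinarith
      calc _ = C₁ ^ 2 * (h ^ α) ^ 2 + σ ^ 2 := by simp; ring
        _ ≤ C₁ ^ 2 * (b ^ (2 * α) * R) + a⁻¹ ^ d * R := by gcongr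
        _ = (C₁ ^ 2 * b ^ (2 * α) + a⁻¹ ^ d) * R := by ring
        _ ≤ _ := by
          exact mul_le_mul_of_nonneg_right (le_add_of_nonneg_right (by positivity)) hR0
  · refine (moRisk_le hα hC₀ hr hn hP clip hh fun Ω => sum_leverage_le r Ω hh h1).trans
      (ENNReal.ofReal_le_ofReal ?_)
    have ht0 : (0 : ℝ) < t := by exact_mod_cast h1
    have ht1 : (1 : ℝ) ≤ t := by exact_mod_cast h1
    -- Without the cap, `n h < t + 1 ≤ 2 t`; with it, `t = n`, and `H ≤ 1` suffices.
    have hnH : n * H ≤ (2 / a + 1) * t := by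
      rcases min_choice ⌊n * h⌋₊ n with hc | hc
      · have h3 : (n * h : ℝ) < t + 1 := by
          rw [ht, pixelRadius, hc]
          exact Nat.lt_floor_add_one _
        have h4 : n * (a * H) ≤ 2 * t := by
          have : n * (a * H) ≤ n * h := by gcongr
          linarith
        have h5 : n * H ≤ 2 / a * t := by
          rw [div_mul_eq_mul_div, le_div_iff₀ ha]
          linarith
        linarith
      · have h3 : (t : ℝ) = n := by rw [ht, pixelRadius, hc]
        have h4 : n * H ≤ t := by
          rw [h3]
          exact mul_le_of_le_one_right hn'.le hH1
        have : 0 ≤ 2 / a * t := by positivity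
        linarith
    have h6 : ((C₁ * h ^ α) ^ 2 * (2 * t + 1) ^ d + σ ^ 2) *
        (2 * polyDim d r * (2 * n / t) ^ d) / n ^ d =
        (C₁ ^ 2 * (h ^ α) ^ 2 * (2 * t + 1) ^ d + σ ^ 2) * D / t ^ d := by
      rw [hD, div_pow, mul_pow, mul_pow 2 (n : ℝ)]
      field_simp
    rw [← hC₁, ← ht, h6, div_le_iff₀ (by positivity)]
    have h7 : σ ^ 2 ≤ (2 / a + 1) ^ d * t ^ d * R := by
      rw [hσ2, ← mul_pow]
      gcongr
    calc _ ≤ (C₁ ^ 2 * (b ^ (2 * α) * R) * (3 * t) ^ d + (2 / a + 1) ^ d * t ^ d * R) * D := by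
          gcongr
          linarith
      _ = (C₁ ^ 2 * b ^ (2 * α) * 3 ^ d * D + D * (2 / a + 1) ^ d) * R * t ^ d := by
          rw [mul_pow]
          ring
      _ ≤ _ := by
          exact mul_le_mul_of_nonneg_right
            (mul_le_mul_of_nonneg_right (le_add_of_nonneg_left (by positivity)) hR0) (by positivity)

end Upper

/-! ### Trains of bumps -/

section Bumps

/-- A smooth bump supported in `[0,1]` which equals `1` on `[1/4, 3/4]`. -/
noncomputable def unitBump : ContDiffBump (1 / 2 : ℝ) := ⟨1 / 4, 1 / 2, by norm_num, by norm_num⟩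

lemma unitBump_eq_one {y : ℝ} (h0 : 1 / 4 ≤ y) (h1 : y ≤ 3 / 4) : unitBump y = 1 := by
  refine unitBump.one_of_mem_closedBall ?_
  rw [Metric.mem_closedBall, Real.dist_eq, abs_le]
  constructor <;> simp only [unitBump] <;> linarith

lemma unitBump_eq_zero {y : ℝ} (h : y ≤ 0 ∨ 1 ≤ y) : unitBump y = 0 := by
  refine unitBump.zero_of_le_dist ?_
  rw [Real.dist_eq, le_abs]
  simp only [unitBump]
  rcases h with h | h
  · right; linarith
  · left; linarith

lemma iteratedDeriv_unitBump_eq_zero (k : ℕ) {y : ℝ} (h : y < 0 ∨ 1 < y) :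
    iteratedDeriv k unitBump y = 0 := by
  have h1 : y ∉ tsupport unitBump := by
    rw [unitBump.tsupport_eq, Metric.mem_closedBall, Real.dist_eq, not_le, lt_abs]
    simp only [unitBump]
    rcases h with h | h
    · right; linarith
    · left; linarith
  have h2 := mt (fun hc => support_iteratedFDeriv_subset (𝕜 := ℝ) k hc) h1
  rw [Function.mem_support, not_not] at h2
  rw [iteratedDeriv, h2]
  rfl

lemma exists_bound_iteratedDeriv_unitBump (l : ℕ) :
    ∃ B : ℝ, 2 ≤ B ∧ ∀ k ≤ l, ∀ y, |iteratedDeriv k unitBump y| ≤ B := by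
  have h : ∀ k, ∃ B : ℝ, ∀ y, |iteratedDeriv k unitBump y| ≤ B := by
    intro k
    have hc : Continuous (iteratedFDeriv ℝ k unitBump) :=
      (unitBump.contDiff (n := k)).continuous_iteratedFDeriv le_rfl
    obtain ⟨B, hB⟩ := (unitBump.hasCompactSupport.iteratedFDeriv (𝕜 := ℝ) k).exists_bound_of_continuous
      hc
    refine ⟨B, fun y => ?_⟩
    rw [← Real.norm_eq_abs, ← norm_iteratedFDeriv_eq_norm_iteratedDeriv]
    exact hB y
  choose B hB using h
  refine ⟨2 + ∑ k ∈ Finset.range (l + 1), |B k|, by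
    linarith [Finset.sum_nonneg fun k (_ : k ∈ Finset.range (l + 1)) => abs_nonneg (B k)],
    fun k hk y => ?_⟩
  have h1 := Finset.single_le_sum (f := fun k => |B k|) (fun k _ => abs_nonneg (B k))
    (Finset.mem_range.2 (Nat.lt_succ_of_le hk))
  linarith [hB k y, le_abs_self (B k)]

/-- The sum of the unit bumps in the cells `[q, q + 1]`, `q ∈ s`. -/
noncomputable def bumpTrain (s : Finset ℕ) (y : ℝ) : ℝ := ∑ q ∈ s, unitBump (y - q)

lemma contDiff_bumpTrain (s : Finset ℕ) (N : ℕ) : ContDiff ℝ N (bumpTrain s) :=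
  ContDiff.sum fun _ _ => unitBump.contDiff.comp (contDiff_id.sub contDiff_const)

lemma iteratedDeriv_bumpTrain (s : Finset ℕ) (k : ℕ) (y : ℝ) :
    iteratedDeriv k (bumpTrain s) y = ∑ q ∈ s, iteratedDeriv k unitBump (y - q) := by
  have h : ∀ q ∈ s, ContDiffAt ℝ k (fun y : ℝ => unitBump (y - q)) y := fun q _ =>
    (unitBump.contDiff.comp (contDiff_id.sub contDiff_const)).contDiffAt
  unfold bumpTrain
  rw [iteratedDeriv_fun_sum h]
  refine Finset.sum_congr rfl fun q _ => ?_
  rw [iteratedDeriv_comp_sub_const]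

/-- A point lies in at most two of the closed unit cells, whence the factor two, whatever `s` is. -/
lemma abs_iteratedDeriv_bumpTrain_le {k : ℕ} {B : ℝ}
    (hB : ∀ y, |iteratedDeriv k unitBump y| ≤ B) (s : Finset ℕ) (y : ℝ) :
    |iteratedDeriv k (bumpTrain s) y| ≤ 2 * B := by
  have hB0 : 0 ≤ B := (abs_nonneg _).trans (hB 0)
  rw [iteratedDeriv_bumpTrain]
  rw [← Finset.sum_filter_of_ne (p := fun q : ℕ => (q : ℝ) ≤ y ∧ y ≤ q + 1)]
  · refine (Finset.abs_sum_le_sum_abs _ _).trans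
      ((Finset.sum_le_card_nsmul _ _ B fun q _ => hB _).trans ?_)
    rw [nsmul_eq_mul]
    refine mul_le_mul_of_nonneg_right ?_ hB0
    have h1 : (s.filter fun q : ℕ => (q : ℝ) ≤ y ∧ y ≤ q + 1) ⊆
        Finset.Icc (⌊y⌋₊ - 1) ⌊y⌋₊ := by
      intro q hq
      obtain ⟨-, h0, h1⟩ := Finset.mem_filter.1 hq
      rw [Finset.mem_Icc]
      have h2 : q ≤ ⌊y⌋₊ := Nat.le_floor h0
      have h3 : ⌊y⌋₊ ≤ q + 1 := Nat.floor_le_of_le (by push_cast; exact h1)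
      omega
    have h2 := Finset.card_le_card h1
    rw [Nat.card_Icc] at h2
    have h3 : (s.filter fun q : ℕ => (q : ℝ) ≤ y ∧ y ≤ q + 1).card ≤ 2 := by omega
    exact_mod_cast h3
  · intro q _ hq
    by_contra hc
    refine hq (iteratedDeriv_unitBump_eq_zero k ?_)
    by_contra hcon
    push Not at hcon
    exact hc ⟨by linarith, by linarith⟩

lemma bumpTrain_mem_Icc (s : Finset ℕ) (y : ℝ) : bumpTrain s y ∈ Set.Icc (0 : ℝ) 2 := by
  refine ⟨Finset.sum_nonneg fun _ _ => unitBump.nonneg, ?_⟩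
  have h := abs_iteratedDeriv_bumpTrain_le (k := 0) (B := 1) (fun y => by
    rw [iteratedDeriv_zero, abs_of_nonneg unitBump.nonneg]
    exact unitBump.le_one) s y
  rw [iteratedDeriv_zero] at h
  linarith [le_abs_self (bumpTrain s y)]

/-- A train of bumps of width `ρ`, on top of the constant `c`. -/
noncomputable def scaledTrain (c A α ρ : ℝ) (s : Finset ℕ) (y : ℝ) : ℝ :=
  c + A * ρ ^ α * bumpTrain s (ρ⁻¹ * y)

lemma contDiff_scaledTrain (c A α ρ : ℝ) (s : Finset ℕ) (N : ℕ) :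
    ContDiff ℝ N (scaledTrain c A α ρ s) :=
  contDiff_const.add (contDiff_const.mul
    ((contDiff_bumpTrain s N).comp (contDiff_const.mul contDiff_id)))

lemma iteratedDeriv_scaledTrain (c A α ρ : ℝ) (s : Finset ℕ) (k : ℕ) (y : ℝ) :
    iteratedDeriv k (scaledTrain c A α ρ s) y =
      (if k = 0 then c else 0) +
        A * ρ ^ α * (ρ⁻¹ ^ k * iteratedDeriv k (bumpTrain s) (ρ⁻¹ * y)) := by
  have h1 : ContDiff ℝ k (fun y => bumpTrain s (ρ⁻¹ * y)) :=
    (contDiff_bumpTrain s k).comp (contDiff_const.mul contDiff_id)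
  unfold scaledTrain
  rw [iteratedDeriv_fun_add contDiff_const.contDiffAt (contDiff_const.mul h1).contDiffAt,
    iteratedDeriv_const, iteratedDeriv_const_mul_field,
    iteratedDeriv_comp_const_mul (contDiff_bumpTrain s k)]

variable {d : ℕ}

/-- The function depends on one coordinate only, so every derivative in another direction kills it.
-/
lemma partialDeriv_comp_apply {u : ℝ → ℝ} {k : ℕ} (hu : ContDiff ℝ k u) (k₀ : Fin d)
    (v : Fin k → Fin d) {x : Fin d → ℝ} (hx : x ∈ cube d) :
    partialDeriv v (fun x => u (x k₀)) x =
      (if ∀ m, v m = k₀ then 1 else 0) * iteratedDeriv k u (x k₀) := by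
  have h0 : (fun x : Fin d → ℝ => u (x k₀)) =
      u ∘ (ContinuousLinearMap.proj k₀ : (Fin d → ℝ) →L[ℝ] ℝ) := rfl
  rw [partialDeriv, h0, iteratedFDerivWithin_eq_iteratedFDeriv uniqueDiffOn_cube
    ((hu.comp (ContinuousLinearMap.contDiff _)).contDiffAt) hx,
    ContinuousLinearMap.iteratedFDeriv_comp_right _ hu _ le_rfl]
  rw [ContinuousMultilinearMap.compContinuousLinearMap_apply,
    iteratedFDeriv_apply_eq_iteratedDeriv_mul_prod, smul_eq_mul]
  congr 1
  simp only [ContinuousLinearMap.proj_apply, Pi.single_apply]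
  rw [Finset.prod_ite_zero]
  simp [eq_comm]

/-- Interpolates between a sup bound and a Lipschitz bound to give a Hölder bound. -/
lemma min_one_le_rpow {z β : ℝ} (hz : 0 ≤ z) (hβ0 : 0 ≤ β) (hβ1 : β ≤ 1) : min 1 z ≤ z ^ β := by
  rcases le_total 1 z with h | h
  · rw [min_eq_left h]
    exact Real.one_le_rpow h hβ0
  · rw [min_eq_right h]
    rcases hz.eq_or_lt with rfl | hz'
    · exact Real.rpow_nonneg le_rfl _
    · simpa using Real.rpow_le_rpow_of_exponent_ge hz' h hβ1

/-- The height `ρ ^ α` compensates the factors `ρ⁻¹ ^ k` from differentiation, so the Hölder bounds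
are uniform in `ρ ≤ 1` and in `s`. The amplitude `1 / (4 B)` absorbs the bounds on the unit bump and
keeps the train below `1 / 4`. -/
lemma isHolder_scaledTrain {α C₀ : ℝ} (hα : 0 < α) (hC₀ : 1 ≤ C₀) (k₀ : Fin d) {B : ℝ}
    (hB2 : 2 ≤ B) (hB : ∀ k ≤ holderOrder α + 1, ∀ y, |iteratedDeriv k unitBump y| ≤ B)
    {c ρ : ℝ} (hc : c ∈ Set.Icc (0 : ℝ) (3 / 4)) (hρ0 : 0 < ρ) (hρ1 : ρ ≤ 1) (s : Finset ℕ) :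
    IsHolder d α C₀ (fun x => scaledTrain c (1 / (4 * B)) α ρ s (x k₀)) := by
  have hB0 : 0 < B := by linarith
  have hlα := holderOrder_lt hα
  have hαl := le_holderOrder_add_one hα
  set l := holderOrder α with hl
  have hρα : ρ ^ α ≤ 1 := Real.rpow_le_one hρ0.le hρ1 hα.le
  have hρk : ∀ k : ℕ, ρ ^ α * ρ⁻¹ ^ k = ρ ^ (α - k) := by
    intro k
    rw [Real.rpow_sub hρ0, Real.rpow_natCast, inv_pow, div_eq_mul_inv]
  have hD := fun k hk => abs_iteratedDeriv_bumpTrain_le (hB k hk) s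
  refine ⟨fun x _ => ?_, ?_, fun x hx k hk1 hkl v => ?_, fun x hx x' hx' v => ?_⟩
  · obtain ⟨h0, h2⟩ := bumpTrain_mem_Icc s (ρ⁻¹ * x k₀)
    have h3 : 0 ≤ 1 / (4 * B) * ρ ^ α := by positivity
    have h4 : 1 / (4 * B) * ρ ^ α ≤ 1 / 8 := by
      calc 1 / (4 * B) * ρ ^ α ≤ 1 / (4 * 2) * 1 := by gcongr
        _ = 1 / 8 := by norm_num
    simp only [scaledTrain]
    constructor
    · have := mul_nonneg h3 h0
      linarith [hc.1]
    · have := mul_le_mul h4 h2 h0 (by norm_num)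
      linarith [hc.2]
  · exact ((contDiff_scaledTrain c _ α ρ s l).comp (contDiff_apply ℝ ℝ k₀)).contDiffOn
  · rw [partialDeriv_comp_apply (contDiff_scaledTrain _ _ _ _ _ _) k₀ v hx,
      iteratedDeriv_scaledTrain, if_neg (show ¬ k = 0 by omega), zero_add, abs_mul]
    have h1 : |(if ∀ m, v m = k₀ then 1 else 0 : ℝ)| ≤ 1 := by split_ifs <;> simp
    have h2 : |1 / (4 * B) * ρ ^ α * (ρ⁻¹ ^ k * iteratedDeriv k (bumpTrain s) (ρ⁻¹ * x k₀))| ≤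
        C₀ := by
      have e : 1 / (4 * B) * ρ ^ α * (ρ⁻¹ ^ k * iteratedDeriv k (bumpTrain s) (ρ⁻¹ * x k₀)) =
          (1 / (4 * B) * ρ ^ (α - k)) * iteratedDeriv k (bumpTrain s) (ρ⁻¹ * x k₀) := by
        rw [← hρk]
        ring
      rw [e, abs_mul, abs_of_nonneg (by positivity : 0 ≤ 1 / (4 * B) * ρ ^ (α - k))]
      have hkl' : (k : ℝ) ≤ l := by exact_mod_cast hkl
      calc 1 / (4 * B) * ρ ^ (α - k) * |iteratedDeriv k (bumpTrain s) (ρ⁻¹ * x k₀)|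
          ≤ 1 / (4 * B) * 1 * (2 * B) := by
            gcongr
            · exact Real.rpow_le_one hρ0.le hρ1 (by linarith)
            · exact hD k (by omega) _
        _ = 1 / 2 := by field_simp; norm_num
        _ ≤ C₀ := by linarith
    calc _ ≤ 1 * C₀ := mul_le_mul h1 h2 (abs_nonneg _) zero_le_one
      _ = C₀ := one_mul _
  · rw [partialDeriv_comp_apply (contDiff_scaledTrain _ _ _ _ _ _) k₀ v hx,
      partialDeriv_comp_apply (contDiff_scaledTrain _ _ _ _ _ _) k₀ v hx', ← mul_sub,
      iteratedDeriv_scaledTrain, iteratedDeriv_scaledTrain, abs_mul]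
    have h1 : |(if ∀ m, v m = k₀ then 1 else 0 : ℝ)| ≤ 1 := by split_ifs <;> simp
    set G := iteratedDeriv l (bumpTrain s) with hG
    have hz : |ρ⁻¹ * x k₀ - ρ⁻¹ * x' k₀| ≤ ‖x - x'‖ / ρ := by
      rw [← mul_sub, abs_mul, abs_of_pos (inv_pos.2 hρ0), inv_mul_eq_div]
      gcongr
      exact norm_le_pi_norm (x - x') k₀
    have hG1 : |G (ρ⁻¹ * x k₀) - G (ρ⁻¹ * x' k₀)| ≤ 4 * B := by
      refine (abs_sub _ _).trans ?_
      linarith [hD l (by omega) (ρ⁻¹ * x k₀), hD l (by omega) (ρ⁻¹ * x' k₀)]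
    have hG2 : |G (ρ⁻¹ * x k₀) - G (ρ⁻¹ * x' k₀)| ≤ 4 * B * (‖x - x'‖ / ρ) := by
      have hdiff : ∀ y ∈ Set.univ, HasDerivWithinAt G (iteratedDeriv (l + 1) (bumpTrain s) y)
          Set.univ y := by
        intro y _
        rw [iteratedDeriv_succ]
        exact (((contDiff_bumpTrain s (l + 1)).differentiable_iteratedDeriv l
          (by exact_mod_cast Nat.lt_succ_self l)) y).hasDerivAt.hasDerivWithinAt
      have := convex_univ.norm_image_sub_le_of_norm_hasDerivWithin_le hdiff
        (fun y _ => hD (l + 1) le_rfl y) (Set.mem_univ (ρ⁻¹ * x' k₀)) (Set.mem_univ (ρ⁻¹ * x k₀))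
      rw [Real.norm_eq_abs, Real.norm_eq_abs] at this
      refine this.trans ?_
      gcongr
      linarith
    have hG3 : |G (ρ⁻¹ * x k₀) - G (ρ⁻¹ * x' k₀)| ≤ 4 * B * (‖x - x'‖ / ρ) ^ (α - l) := by
      refine le_trans ?_ (mul_le_mul_of_nonneg_left
        (min_one_le_rpow (by positivity) (by linarith) (by linarith)) (by linarith))
      rw [mul_min_of_nonneg _ _ (by linarith), mul_one]
      exact le_min hG1 hG2
    have e : (if l = 0 then c else 0) + 1 / (4 * B) * ρ ^ α * (ρ⁻¹ ^ l * G (ρ⁻¹ * x k₀)) -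
        ((if l = 0 then c else 0) + 1 / (4 * B) * ρ ^ α * (ρ⁻¹ ^ l * G (ρ⁻¹ * x' k₀))) =
        (1 / (4 * B) * ρ ^ (α - l)) * (G (ρ⁻¹ * x k₀) - G (ρ⁻¹ * x' k₀)) := by
      rw [← hρk]
      ring
    rw [e, abs_mul, abs_of_nonneg (by positivity : 0 ≤ 1 / (4 * B) * ρ ^ (α - l))]
    calc _ ≤ 1 * (1 / (4 * B) * ρ ^ (α - l) * (4 * B * (‖x - x'‖ / ρ) ^ (α - l))) := by
          gcongr
      _ = ‖x - x'‖ ^ (α - l) := by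
          rw [Real.div_rpow (norm_nonneg _) hρ0.le]
          have : 0 < ρ ^ (α - l) := by positivity
          field_simp
      _ ≤ C₀ * ‖x - x'‖ ^ (α - l) := le_mul_of_one_le_left (by positivity) hC₀

end Bumps

/-! ### Cartoon images with a ball as foreground -/

section Ball

variable {d : ℕ} {α C₀ : ℝ}

/-- A cartoon image whose foreground is the ball of radius `1/2` around the centre of the cube. -/
noncomputable def ballImage (hC₀ : 2 ≤ C₀) {fg bg : (Fin d → ℝ) → ℝ} (hfg : IsHolder d α C₀ fg)
    (hbg : IsHolder d α C₀ bg) (hjump : ∀ x, fg x - bg x = 1 / 2) : CartoonImage d α C₀ where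
  Ω := (fun u : Fin d → ℝ => fun k => 1 / 2 + u k / 2) '' {u | ∑ k, u k ^ 2 < 1}
  fg := fg
  bg := bg
  holder_fg := hfg
  holder_bg := hbg
  jump x _ := by
    rw [hjump, abs_of_pos (by norm_num)]
    exact one_div_le_one_div_of_le (by norm_num) hC₀
  subset := by
    rintro _ ⟨u, hu, rfl⟩ k
    have h1 : u k ^ 2 < 1 := lt_of_le_of_lt
      (Finset.single_le_sum (f := fun k => u k ^ 2) (fun k _ => sq_nonneg _) (Finset.mem_univ k)) hu
    have h2 := abs_lt.1 ((sq_lt_one_iff_abs_lt_one _).1 h1)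
    constructor <;> simp only <;> linarith [h2.1, h2.2]
  biLipschitz := by
    have e : ∀ u v : Fin d → ℝ, ‖(fun k => 1 / 2 + u k / 2) - (fun k => 1 / 2 + v k / 2)‖ =
        1 / 2 * ‖u - v‖ := by
      intro u v
      have : ((fun k => 1 / 2 + u k / 2) - (fun k => 1 / 2 + v k / 2) : Fin d → ℝ) =
          (1 / 2 : ℝ) • (u - v) := by
        ext k
        simp
        ring
      rw [this, norm_smul]
      norm_num
    refine ⟨_, fun u v huv => ?_, fun u v => ?_, fun u v => ?_, rfl⟩
    · ext k
      have : 1 / 2 + u k / 2 = 1 / 2 + v k / 2 := congrFun huv k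
      linarith
    · rw [e]
      nlinarith [norm_nonneg (u - v)]
    · rw [e]
      nlinarith [norm_nonneg (u - v)]

end Ball

/-! ### Lower bounds for the risk at a pixel -/

section Noise

variable {d n : ℕ}

/-- The risk of the estimator of `m` with bias `b` and weights `w` is, up to a constant factor and
up to saturation, at least its squared bias and at least its variance. -/
def IsDetected (clip : Bool) (σ κ : ℝ) (P : Measure (Grid d n → ℝ)) : Prop :=
  ∀ (w : Grid d n → ℝ) (b : ℝ), ∀ m ∈ Set.Icc (1 / 8 : ℝ) (7 / 8),
    ENNReal.ofReal (κ * min (max (b ^ 2) (σ ^ 2 * ∑ j, w j ^ 2)) 1) ≤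
      ∫⁻ ε, ENNReal.ofReal ((truncate clip (m + (b + ∑ j, w j * ε j)) - m) ^ 2) ∂P

lemma isDetected_of_mem_whiteNoise {σ : ℝ} {P : Measure (Grid d n → ℝ)}
    (hP : P ∈ whiteNoise d n σ) : IsDetected false σ 1 P := by
  intro w b m _
  simp only [truncate, Bool.false_eq_true, if_false, add_sub_cancel_left]
  rw [lintegral_affine_sq hP]
  refine ENNReal.ofReal_le_ofReal ?_
  rw [one_mul]
  have h1 : 0 ≤ σ ^ 2 * ∑ j, w j ^ 2 := by positivity
  refine (min_le_left _ _).trans (max_le ?_ ?_) <;> nlinarith [sq_nonneg b]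

lemma iidNoise_subset_whiteNoise {ν : Measure ℝ} (hν : IsStandardized ν) (σ : ℝ) :
    iidNoise ν d n σ ⊆ whiteNoise d n σ := by
  rintro P hP
  obtain ⟨hprob, hL2, h0, h1⟩ := hν
  rw [iidNoise, Set.mem_singleton_iff] at hP
  subst hP
  have hmeas : Measurable fun t : ℝ => σ * t := measurable_const_mul σ
  have hprob' : IsProbabilityMeasure (ν.map fun t => σ * t) :=
    Measure.isProbabilityMeasure_map hmeas.aemeasurable
  set μ := ν.map fun t => σ * t with hμ
  have hL2' : MemLp (fun t : ℝ => t) 2 μ := by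
    rw [hμ, memLp_map_measure_iff (by fun_prop) hmeas.aemeasurable]
    exact hL2.const_mul σ
  have hmp : ∀ i : Grid d n, MeasurePreserving (Function.eval i) (Measure.pi fun _ => μ) μ :=
    fun i => measurePreserving_eval (fun _ => μ) i
  have hmean : ∫ t, t ∂μ = 0 := by
    rw [hμ, integral_map hmeas.aemeasurable (by fun_prop), integral_const_mul, h0, mul_zero]
  have hsq : ∫ t, t ^ 2 ∂μ = σ ^ 2 := by
    rw [hμ, integral_map hmeas.aemeasurable (by fun_prop)]
    simp_rw [mul_pow]
    rw [integral_const_mul, h1, mul_one]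
  have hm : ∀ i : Grid d n, ∫ ε, ε i ∂(Measure.pi fun _ : Grid d n => μ) = 0 := by
    intro i
    rw [← hmean]
    conv_rhs => rw [← (hmp i).map_eq]
    rw [integral_map (hmp i).aemeasurable (by fun_prop)]
  refine ⟨inferInstance, fun i => hL2'.comp_measurePreserving (hmp i), hm, fun i j => ?_⟩
  split_ifs with hij
  · subst hij
    rw [← hsq]
    conv_rhs => rw [← (hmp i).map_eq]
    rw [integral_map (hmp i).aemeasurable (by fun_prop)]
    simp only [sq]
  · have hind := (iIndepFun_pi (μ := fun _ : Grid d n => μ) (X := fun _ t => t)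
      (fun _ => aemeasurable_id)).indepFun hij
    rw [hind.integral_fun_mul_eq_mul_integral
      (measurable_pi_apply i).aestronglyMeasurable (measurable_pi_apply j).aestronglyMeasurable, hm i, zero_mul]

/-- Since `m` is at distance at least `1 / 8` from both ends, clipping hides only the part of an
error beyond `1 / 8`. -/
lemma min_abs_le_abs_truncate_sub {m : ℝ} (hm : m ∈ Set.Icc (1 / 8 : ℝ) (7 / 8)) (x : ℝ) :
    min |x| (1 / 8) ≤ |truncate true (m + x) - m| := by
  obtain ⟨h0, h1⟩ := hm
  simp only [truncate, if_true]
  rcases le_total (m + x) 0 with hz | hz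
  · rw [min_eq_right (by linarith : m + x ≤ 1), max_eq_left hz,
      abs_of_nonpos (by linarith : 0 - m ≤ 0)]
    exact (min_le_right _ _).trans (by linarith)
  · rcases le_total 1 (m + x) with hz1 | hz1
    · rw [min_eq_left hz1, max_eq_right zero_le_one,
        abs_of_nonneg (by linarith : 0 ≤ 1 - m)]
      exact (min_le_right _ _).trans (by linarith)
    · rw [min_eq_right hz1, max_eq_right hz, add_sub_cancel_left]
      exact min_le_left _ _

/-- Turns a saturated square into a cosine, whose mean is controlled by characteristic functions.
The constant is forced by `2 = 128 * (1 / 8) ^ 2`. -/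
lemma one_sub_cos_mul_le {l : ℝ} (h0 : 0 ≤ l) (h1 : l ≤ 1) (x : ℝ) :
    1 - Real.cos (l * x) ≤ 128 * min |x| (1 / 8) ^ 2 := by
  rcases le_total |x| (1 / 8) with h | h
  · rw [min_eq_left h, sq_abs]
    have h2 := Real.one_sub_sq_div_two_le_cos (x := l * x)
    have h3 : l ^ 2 ≤ 1 := pow_le_one₀ h0 h1
    have h4 : (l * x) ^ 2 ≤ x ^ 2 := by
      rw [mul_pow]
      exact mul_le_of_le_one_left (sq_nonneg x) h3
    nlinarith [sq_nonneg x]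
  · rw [min_eq_right h]
    linarith [Real.neg_one_le_cos (l * x)]

/-- Near the origin the characteristic function of a standardized law is bounded by a Gaussian. -/
lemma IsStandardized.exists_norm_charFun_le {ν : Measure ℝ} (hν : IsStandardized ν) :
    ∃ u₀ : ℝ, 0 < u₀ ∧ u₀ ≤ 1 ∧ ∀ u, |u| ≤ u₀ → ‖charFun ν u‖ ≤ Real.exp (-(u ^ 2 / 4)) := by
  obtain ⟨hprob, hL2, h0, h1⟩ := hν
  have h := taylor_charFun_two (P := ν) (X := fun t => t) aemeasurable_id h0 h1
  have hid : ν.map (fun t => t) = ν := Measure.map_id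
  rw [hid] at h
  -- An error of `u² / 4` in the second-order expansion leaves `1 - u² / 2 + u² / 4 = 1 - u² / 4`,
  -- which is below the exponential.
  have h2 := h.def (c := 1 / 4) (by norm_num)
  obtain ⟨δ, hδ, hball⟩ := Metric.eventually_nhds_iff.1 h2
  refine ⟨min (δ / 2) 1, by positivity, min_le_right _ _, fun u hu => ?_⟩
  have hu1 : |u| ≤ 1 := hu.trans (min_le_right _ _)
  have hu2 : u ^ 2 ≤ 1 := (sq_le_one_iff_abs_le_one u).2 hu1
  have h3 := @hball u (by
    rw [Real.dist_eq, sub_zero]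
    linarith [hu.trans (min_le_left _ _)])
  have h4 : ‖(1 - (u : ℂ) ^ 2 / 2)‖ = 1 - u ^ 2 / 2 := by
    have : (1 - (u : ℂ) ^ 2 / 2) = ((1 - u ^ 2 / 2 : ℝ) : ℂ) := by push_cast; ring
    rw [this, Complex.norm_real, Real.norm_eq_abs, abs_of_nonneg (by linarith)]
  have h5 := norm_le_norm_add_norm_sub' (charFun ν u) (1 - (u : ℂ) ^ 2 / 2)
  rw [h4] at h5
  rw [Real.norm_eq_abs, abs_of_nonneg (sq_nonneg u)] at h3
  have h6 := Real.add_one_le_exp (-(u ^ 2 / 4))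
  linarith

/-- By independence the characteristic function of the sum is a product, and the Gaussian bounds
multiply. The shift `b` only contributes a phase of modulus one. -/
lemma integral_cos_affine_le {ν : Measure ℝ} [IsProbabilityMeasure ν] {σ u₀ : ℝ}
    (hu : ∀ u, |u| ≤ u₀ → ‖charFun ν u‖ ≤ Real.exp (-(u ^ 2 / 4))) (w : Grid d n → ℝ) (b l : ℝ)
    (hl : ∀ j, |σ * (l * w j)| ≤ u₀) :
    ∫ ε, Real.cos (l * (b + ∑ j, w j * ε j))
        ∂(Measure.pi fun _ : Grid d n => ν.map fun t => σ * t) ≤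
      Real.exp (-(l ^ 2 * (σ ^ 2 * ∑ j, w j ^ 2) / 4)) := by
  have hmeas : Measurable fun t : ℝ => σ * t := measurable_const_mul σ
  have hprob' : IsProbabilityMeasure (ν.map fun t => σ * t) :=
    Measure.isProbabilityMeasure_map hmeas.aemeasurable
  set μ := ν.map fun t => σ * t with hμ
  have hint : Integrable (fun ε : Grid d n → ℝ =>
      Complex.exp ((l * (b + ∑ j, w j * ε j) : ℝ) * Complex.I))
      (Measure.pi fun _ : Grid d n => μ) := by
    refine Integrable.of_bound (Measurable.aestronglyMeasurable (by fun_prop)) 1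
      (Filter.Eventually.of_forall fun ε => ?_)
    rw [Complex.norm_exp_ofReal_mul_I]
  have e1 : ∫ ε, Real.cos (l * (b + ∑ j, w j * ε j)) ∂(Measure.pi fun _ : Grid d n => μ) =
      (∫ ε, Complex.exp ((l * (b + ∑ j, w j * ε j) : ℝ) * Complex.I)
        ∂(Measure.pi fun _ : Grid d n => μ)).re := by
    rw [← RCLike.re_eq_complex_re, ← integral_re hint]
    simp only [RCLike.re_eq_complex_re, Complex.exp_ofReal_mul_I_re]
  have e2 : ∀ ε : Grid d n → ℝ, Complex.exp ((l * (b + ∑ j, w j * ε j) : ℝ) * Complex.I) =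
      Complex.exp ((l * b : ℝ) * Complex.I) *
        ∏ j, Complex.exp ((l * w j : ℝ) * (ε j : ℂ) * Complex.I) := by
    intro ε
    rw [← Complex.exp_sum, ← Complex.exp_add]
    congr 1
    push_cast
    rw [mul_add, Finset.mul_sum, add_mul, Finset.sum_mul]
    congr 1
    exact Finset.sum_congr rfl fun j _ => by ring
  rw [e1]
  refine (Complex.re_le_norm _).trans ?_
  simp_rw [e2]
  rw [integral_const_mul, norm_mul, Complex.norm_exp_ofReal_mul_I, one_mul,
    integral_fintype_prod_eq_prod (μ := fun _ : Grid d n => μ)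
      (fun j (x : ℝ) => Complex.exp ((l * w j : ℝ) * (x : ℂ) * Complex.I)), norm_prod]
  have e3 : ∀ j, ‖∫ x, Complex.exp ((l * w j : ℝ) * (x : ℂ) * Complex.I) ∂μ‖ ≤
      Real.exp (-((σ * (l * w j)) ^ 2 / 4)) := by
    intro j
    rw [← charFun_apply_real, hμ, charFun_map_mul]
    exact hu _ (hl j)
  refine (Finset.prod_le_prod (fun _ _ => norm_nonneg _) fun j _ => e3 j).trans (le_of_eq ?_)
  rw [← Real.exp_sum]
  congr 1
  rw [Finset.mul_sum, Finset.mul_sum, Finset.sum_div, ← Finset.sum_neg_distrib]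
  exact Finset.sum_congr rfl fun j _ => by ring

lemma sq_min_le_two_mul {b x c : ℝ} (hc : 0 ≤ c) :
    min |b| c ^ 2 ≤ 2 * min |b + x| c ^ 2 + 2 * x ^ 2 := by
  have h1 : min |b| c ≤ min |b + x| c + |x| := by
    rcases le_total |b + x| c with h | h
    · rw [min_eq_left h]
      refine (min_le_left _ _).trans ?_
      have := abs_sub (b + x) x
      rwa [add_sub_cancel_right] at this
    · rw [min_eq_right h]
      exact (min_le_right _ _).trans (by linarith [abs_nonneg x])
  have h2 : 0 ≤ min |b| c := le_min (abs_nonneg _) hc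
  have h3 : 0 ≤ min |b + x| c := le_min (abs_nonneg _) hc
  calc min |b| c ^ 2 ≤ (min |b + x| c + |x|) ^ 2 := by gcongr
    _ ≤ 2 * min |b + x| c ^ 2 + 2 * x ^ 2 := by
      rw [← sq_abs x]
      nlinarith [sq_nonneg (min |b + x| c - |x|)]

/-- The variance is detected through the cosine transform, whatever the bias. The bias is detected
by comparison with the noiseless error, at the cost of the variance. One of the two bounds suffices
according to which term dominates. -/
lemma IsStandardized.exists_isDetected {ν : Measure ℝ} (hν : IsStandardized ν) :
    ∃ κ : ℝ, 0 < κ ∧ ∀ (d n : ℕ) (σ : ℝ), ∀ P ∈ iidNoise ν d n σ, IsDetected true σ κ P := by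
  obtain ⟨u₀, hu0, hu1, hu⟩ := hν.exists_norm_charFun_le
  have hprobν := hν.1
  refine ⟨u₀ ^ 2 / 1024 / 256, by positivity, ?_⟩
  intro d n σ P hP w b m hm
  have hwhite := iidNoise_subset_whiteNoise hν σ hP
  have hprob := hwhite.1
  rw [iidNoise, Set.mem_singleton_iff] at hP
  set V := σ ^ 2 * ∑ j, w j ^ 2 with hV
  have hV0 : 0 ≤ V := by positivity
  set X : (Grid d n → ℝ) → ℝ := fun ε => b + ∑ j, w j * ε j with hX
  have hXm : Measurable X := (measurable_sum_mul w).const_add b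
  have hint : Integrable (fun ε => min |X ε| (1 / 8) ^ 2) P := by
    refine Integrable.of_bound (by fun_prop) 1 (Filter.Eventually.of_forall fun ε => ?_)
    have h0 : 0 ≤ min |X ε| (1 / 8) := le_min (abs_nonneg _) (by norm_num)
    have h1 : min |X ε| (1 / 8) ≤ 1 / 8 := min_le_right _ _
    rw [Real.norm_eq_abs, abs_of_nonneg (by positivity)]
    nlinarith
  set E := ∫ ε, min |X ε| (1 / 8) ^ 2 ∂P with hE
  have hlow : ENNReal.ofReal E ≤
      ∫⁻ ε, ENNReal.ofReal ((truncate true (m + (b + ∑ j, w j * ε j)) - m) ^ 2) ∂P := by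
    rw [hE, ofReal_integral_eq_lintegral_ofReal hint
      (Filter.Eventually.of_forall fun _ => sq_nonneg _)]
    refine lintegral_mono fun ε => ENNReal.ofReal_le_ofReal ?_
    rw [← sq_abs (truncate true _ - m)]
    exact pow_le_pow_left₀ (le_min (abs_nonneg _) (by norm_num))
      (min_abs_le_abs_truncate_sub hm _) 2
  refine le_trans (ENNReal.ofReal_le_ofReal ?_) hlow
  have hvar : u₀ ^ 2 / 1024 * min V 1 ≤ E := by
    rcases hV0.eq_or_lt with hV00 | hVpos
    · rw [← hV00, min_eq_left zero_le_one, mul_zero]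
      exact integral_nonneg fun _ => sq_nonneg _
    -- The largest admissible frequency: `l √V ≤ u₀` keeps every factor where the Gaussian bound is
    -- valid, and `l ≤ 1` serves the cosine inequality.
    set l := min 1 (u₀ / √V) with hl
    have hsV : 0 < √V := Real.sqrt_pos.2 hVpos
    have hl0 : 0 ≤ l := le_min zero_le_one (by positivity)
    have hl1 : l ≤ 1 := min_le_left _ _
    have hlV : l * √V ≤ u₀ := by
      rw [← le_div_iff₀ hsV]
      exact min_le_right _ _
    have hlj : ∀ j, |σ * (l * w j)| ≤ u₀ := by
      intro j
      refine le_trans ?_ hlV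
      have h1 : |σ * w j| ≤ √V := by
        refine Real.abs_le_sqrt ?_
        rw [mul_pow, hV]
        gcongr
        exact Finset.single_le_sum (f := fun j => w j ^ 2) (fun _ _ => sq_nonneg _)
          (Finset.mem_univ j)
      calc |σ * (l * w j)| = l * |σ * w j| := by
            rw [mul_left_comm, abs_mul, abs_of_nonneg hl0]
        _ ≤ l * √V := by gcongr
    have hcos := integral_cos_affine_le hu w b l hlj
    rw [← hP] at hcos
    have hcint : Integrable (fun ε : Grid d n → ℝ => Real.cos (l * (b + ∑ j, w j * ε j))) P := by
      refine Integrable.of_bound (Measurable.aestronglyMeasurable (by fun_prop)) 1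
        (Filter.Eventually.of_forall fun ε => ?_)
      exact Real.abs_cos_le_one _
    have h2 : 1 - ∫ ε, Real.cos (l * (b + ∑ j, w j * ε j)) ∂P ≤ 128 * E := by
      rw [hE, ← integral_const_mul]
      have h3 : ∫ ε, (1 - Real.cos (l * (b + ∑ j, w j * ε j))) ∂P =
          1 - ∫ ε, Real.cos (l * (b + ∑ j, w j * ε j)) ∂P := by
        rw [integral_sub (integrable_const _) hcint]
        simp
      rw [← h3]
      exact integral_mono ((integrable_const _).sub hcint) (hint.const_mul _)
        fun ε => one_sub_cos_mul_le hl0 hl1 _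
    set x := l ^ 2 * V / 4 with hx
    have hlV2 : u₀ ^ 2 * min V 1 ≤ l ^ 2 * V := by
      rcases min_choice 1 (u₀ / √V) with hc | hc
      · rw [hl, hc, one_pow, one_mul]
        calc u₀ ^ 2 * min V 1 ≤ 1 * V := by
              gcongr
              · exact pow_le_one₀ hu0.le hu1
              · exact min_le_left _ _
          _ = V := one_mul _
      · rw [hl, hc, div_pow, Real.sq_sqrt hV0, div_mul_cancel₀ _ hVpos.ne']
        exact mul_le_of_le_one_right (by positivity) (min_le_right _ _)
    have hlV3 : l ^ 2 * V ≤ 1 := by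
      calc l ^ 2 * V = (l * √V) ^ 2 := by rw [mul_pow, Real.sq_sqrt hV0]
        _ ≤ 1 := pow_le_one₀ (by positivity) (hlV.trans hu1)
    have hx0 : 0 ≤ x := by positivity
    have hx1 : x ≤ 1 := by linarith
    have hexp : Real.exp (-x) ≤ 1 - x / 2 := by
      rw [Real.exp_neg, inv_le_iff_one_le_mul₀ (Real.exp_pos x)]
      nlinarith [Real.add_one_le_exp x]
    have : E ≥ x / 256 := by linarith
    linarith
  have hbias : min (b ^ 2) 1 / 128 - V ≤ E := by
    have hN := integral_affine_sq hwhite 0 w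
    have hNint := integrable_affine_sq hwhite.2.1 0 w
    have h1 : ∫ _ε, min |b| (1 / 8) ^ 2 ∂P ≤
        ∫ ε, (2 * min |X ε| (1 / 8) ^ 2 + 2 * (0 + ∑ j, w j * ε j) ^ 2) ∂P := by
      refine integral_mono (integrable_const _) ((hint.const_mul 2).add (hNint.const_mul 2))
        fun ε => ?_
      rw [zero_add]
      exact sq_min_le_two_mul (by norm_num)
    rw [integral_add (hint.const_mul 2) (hNint.const_mul 2), integral_const_mul,
      integral_const_mul, hN] at h1
    simp only [integral_const, probReal_univ, smul_eq_mul, one_mul] at h1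
    have h2 : min (b ^ 2) 1 ≤ 64 * min |b| (1 / 8) ^ 2 := by
      rcases le_total |b| (1 / 8) with h | h
      · rw [min_eq_left h, sq_abs]
        exact (min_le_left _ _).trans (by nlinarith [sq_nonneg b])
      · rw [min_eq_right h]
        exact (min_le_right _ _).trans (by norm_num)
    linarith
  have hu2 : u₀ ^ 2 ≤ 1 := pow_le_one₀ hu0.le hu1
  have hb0 : 0 ≤ min (b ^ 2) 1 := le_min (sq_nonneg b) zero_le_one
  have hV1 : 0 ≤ min V 1 := le_min hV0 zero_le_one
  rw [min_max_distrib_right, mul_max_of_nonneg _ _ (by positivity)]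
  refine max_le ?_ ?_
  · rcases le_total (min (b ^ 2) 1 / 256) V with h | h
    · have h3 : min (b ^ 2) 1 / 256 ≤ min V 1 :=
        le_min h (by linarith [min_le_right (b ^ 2) 1])
      calc u₀ ^ 2 / 1024 / 256 * min (b ^ 2) 1 = u₀ ^ 2 / 1024 * (min (b ^ 2) 1 / 256) := by ring
        _ ≤ u₀ ^ 2 / 1024 * min V 1 := by gcongr
        _ ≤ E := hvar
    · nlinarith
  · nlinarith [sq_nonneg u₀, mul_nonneg (sq_nonneg u₀) hV1]

end Noise

/-! ### Lower bounds -/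

section Lower

variable {d n : ℕ} {α C₀ : ℝ}

lemma const_mem_localPoly (r : ℕ) (i : Grid d n) : (fun _ => (1 : ℝ)) ∈ localPoly r i := by
  refine ⟨Pi.single (MultiIndex.zero d r) 1, ?_⟩
  ext j
  rw [design_apply, Finset.sum_eq_single (MultiIndex.zero d r)]
  · simp [MultiIndex.zero]
  · intro s _ hs
    rw [Pi.single_eq_of_ne hs, zero_mul]
  · simp

lemma sum_fitWeight (r : ℕ) (Ω : Set (Fin d → ℝ)) {h : ℝ} (hh : 0 < h) (i : Grid d n) :
    ∑ j, fitWeight r Ω h i j = 1 := by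
  have := sum_hatWeight_mul_mem (localPoly r i) _ (self_mem_window Ω hh i)
    (const_mem_localPoly r i)
  simpa [fitWeight] using this

/-- Constants are reproduced, so the weights sum to one, and Cauchy-Schwarz bounds their sum of
squares below by the inverse window size. -/
lemma one_div_le_fitWeight_self (r : ℕ) (Ω : Set (Fin d → ℝ)) {h : ℝ} (hh : 0 < h)
    (i : Grid d n) : 1 / (2 * pixelRadius n h + 1 : ℝ) ^ d ≤ fitWeight r Ω h i i := by
  have hi := self_mem_window Ω hh i
  have h1 := sq_sum_hatWeight_mul_le (localPoly r i) (window Ω h i) hi (window Ω h i)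
    (g := fun _ => 1) (fun j hj hj' => absurd hj hj') (B := 1) (fun _ _ => by norm_num)
  have h2 := sum_fitWeight r Ω hh i
  simp only [mul_one, one_mul, Finset.inter_self] at h1
  simp only [fitWeight] at h2
  rw [h2, one_pow] at h1
  rw [div_le_iff₀' (by positivity)]
  refine h1.trans (mul_le_mul_of_nonneg_right ?_ (fitWeight_self_nonneg r Ω hh i))
  exact_mod_cast card_window_le Ω hh i

lemma le_mse_moEstimator (F : CartoonImage d α C₀) {clip : Bool} {σ κ : ℝ}
    {P : Measure (Grid d n → ℝ)} (hP : IsDetected clip σ κ P) (hκ : 0 ≤ κ) (r : ℕ) {h : ℝ}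
    (hn : 1 ≤ n) (hh : 0 < h) (hF : ∀ i : Grid d n, F.toFun (pt i) ∈ Set.Icc (1 / 8 : ℝ) (7 / 8)) :
    ENNReal.ofReal ((∑ i : Grid d n, κ * min (max
        (((∑ j, fitWeight r F.Ω h i j * F.toFun (pt j)) - F.toFun (pt i)) ^ 2)
          (σ ^ 2 * fitWeight r F.Ω h i i)) 1) / n ^ d) ≤
      mse P (moEstimator clip r F.Ω h) F.toFun := by
  have hn' : (0 : ℝ) < n := by exact_mod_cast hn
  rw [ENNReal.ofReal_div_of_pos (by positivity), ENNReal.ofReal_pow (Nat.cast_nonneg _),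
    ENNReal.ofReal_natCast, ENNReal.ofReal_sum_of_nonneg fun i _ => mul_nonneg hκ
      (le_min (le_max_of_le_left (sq_nonneg _)) zero_le_one)]
  unfold mse
  gcongr with i
  rw [← sum_fitWeight_sq r F.Ω hh i]
  refine (hP _ _ _ (hF i)).trans (le_of_eq ?_)
  refine lintegral_congr fun ε => ?_
  rw [moEstimator_eq clip r F.Ω hh]
  congr 4
  simp only [mul_add, Finset.sum_add_distrib]
  ring

/-- The cartoon images which carry a train of bumps in direction `k₀`. -/
noncomputable def trainImage (hα : 0 < α) (hC₀ : 2 ≤ C₀) (k₀ : Fin d) {B : ℝ} (hB2 : 2 ≤ B)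
    (hB : ∀ k ≤ holderOrder α + 1, ∀ y, |iteratedDeriv k unitBump y| ≤ B) {ρ : ℝ} (hρ0 : 0 < ρ)
    (hρ1 : ρ ≤ 1) (s : Finset ℕ) : CartoonImage d α C₀ :=
  ballImage hC₀
    (isHolder_scaledTrain hα (by linarith) k₀ hB2 hB (c := 5 / 8) (by norm_num) hρ0 hρ1 s)
    (isHolder_scaledTrain hα (by linarith) k₀ hB2 hB (c := 1 / 8) (by norm_num) hρ0 hρ1 s)
    (fun x => by simp only [scaledTrain]; ring)

open Classical in
lemma trainImage_toFun (hα : 0 < α) (hC₀ : 2 ≤ C₀) (k₀ : Fin d) {B : ℝ} (hB2 : 2 ≤ B)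
    (hB : ∀ k ≤ holderOrder α + 1, ∀ y, |iteratedDeriv k unitBump y| ≤ B) {ρ : ℝ} (hρ0 : 0 < ρ)
    (hρ1 : ρ ≤ 1) (s : Finset ℕ) (x : Fin d → ℝ) :
    (trainImage hα hC₀ k₀ hB2 hB hρ0 hρ1 s).toFun x =
      (if x ∈ (trainImage hα hC₀ k₀ hB2 hB hρ0 hρ1 s).Ω then 5 / 8 else 1 / 8) +
        1 / (4 * B) * ρ ^ α * bumpTrain s (ρ⁻¹ * x k₀) := by
  split_ifs with hx
  · rw [CartoonImage.toFun_eq_fg _ hx]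
    rfl
  · rw [CartoonImage.toFun_eq_bg _ hx]
    rfl

lemma trainImage_toFun_mem_Icc (hα : 0 < α) (hC₀ : 2 ≤ C₀) (k₀ : Fin d) {B : ℝ} (hB2 : 2 ≤ B)
    (hB : ∀ k ≤ holderOrder α + 1, ∀ y, |iteratedDeriv k unitBump y| ≤ B) {ρ : ℝ} (hρ0 : 0 < ρ)
    (hρ1 : ρ ≤ 1) (s : Finset ℕ) (x : Fin d → ℝ) :
    (trainImage hα hC₀ k₀ hB2 hB hρ0 hρ1 s).toFun x ∈ Set.Icc (1 / 8 : ℝ) (7 / 8) := by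
  rw [trainImage_toFun]
  obtain ⟨h0, h2⟩ := bumpTrain_mem_Icc s (ρ⁻¹ * x k₀)
  have hB0 : 0 < B := by linarith
  have h3 : 0 ≤ 1 / (4 * B) * ρ ^ α := by positivity
  have h4 : 1 / (4 * B) * ρ ^ α ≤ 1 / 8 := by
    calc 1 / (4 * B) * ρ ^ α ≤ 1 / (4 * 2) * 1 := by
          gcongr
          exact Real.rpow_le_one hρ0.le hρ1 hα.le
      _ = 1 / 8 := by norm_num
  have h5 := mul_nonneg h3 h0
  have h6 := mul_le_mul h4 h2 h0 (by norm_num)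
  split_ifs <;> constructor <;> linarith

/-- Tested on the image without bumps. -/
lemma ofReal_variance_le_moRisk (hd : 1 ≤ d) (hα : 0 < α) (hC₀ : 2 ≤ C₀) {clip : Bool} {σ κ : ℝ}
    {P : Measure (Grid d n → ℝ)} (hP : IsDetected clip σ κ P) (hκ : 0 ≤ κ) (r : ℕ) (hn : 1 ≤ n)
    {h : ℝ} (hh : 0 < h) :
    ENNReal.ofReal (κ * min (σ ^ 2 / (2 * pixelRadius n h + 1) ^ d) 1) ≤
      moRisk clip r α C₀ P h := by
  obtain ⟨B, hB2, hB⟩ := exists_bound_iteratedDeriv_unitBump (holderOrder α + 1)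
  set F := trainImage hα hC₀ ⟨0, hd⟩ hB2 hB zero_lt_one le_rfl ∅
  refine le_trans ?_ (le_iSup _ F)
  refine le_trans (ENNReal.ofReal_le_ofReal ?_) (le_mse_moEstimator F hP hκ r hn hh
    fun i => trainImage_toFun_mem_Icc hα hC₀ _ hB2 hB zero_lt_one le_rfl ∅ _)
  have hn' : (0 : ℝ) < n := by exact_mod_cast hn
  rw [le_div_iff₀ (by positivity), mul_comm]
  have hcard : ((Finset.univ : Finset (Grid d n)).card : ℝ) = n ^ d := by simp
  rw [← hcard, ← nsmul_eq_mul]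
  refine Finset.card_nsmul_le_sum _ _ _ fun i _ => ?_
  gcongr
  refine le_max_of_le_right ?_
  rw [div_eq_mul_one_div]
  exact mul_le_mul_of_nonneg_left (one_div_le_fitWeight_self r F.Ω hh i) (sq_nonneg _)

/-- A random sum with independent signs is at least as spread out as each of its terms. -/
lemma le_sum_powerset_min_sq (c : ℕ → ℝ) {N q : ℕ} (hq : q < N) :
    2 ^ N * (min (c q ^ 2 / 4) 1 / 2) ≤
      ∑ s ∈ (Finset.range N).powerset, min ((∑ k ∈ s, c k) ^ 2) 1 := by
  have hq' : q ∈ Finset.range N := Finset.mem_range.2 hq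
  rw [← Finset.insert_erase hq', Finset.sum_powerset_insert (Finset.notMem_erase _ _),
    ← Finset.sum_add_distrib]
  have hcard : ((Finset.range N).erase q).powerset.card = 2 ^ (N - 1) := by
    rw [Finset.card_powerset, Finset.card_erase_of_mem hq', Finset.card_range]
  -- Subsets are paired by toggling `q`: the two sums differ by `c q`, so they cannot both be
  -- smaller than `|c q| / 2`.
  have h1 : ∀ s ∈ ((Finset.range N).erase q).powerset, min (c q ^ 2 / 4) 1 ≤
      min ((∑ k ∈ s, c k) ^ 2) 1 + min ((∑ k ∈ insert q s, c k) ^ 2) 1 := by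
    intro s hs
    rw [Finset.sum_insert fun hc => Finset.notMem_erase q _ (Finset.mem_powerset.1 hs hc)]
    set x := ∑ k ∈ s, c k
    have h2 : 0 ≤ min (x ^ 2) 1 := le_min (sq_nonneg _) zero_le_one
    have h3 : 0 ≤ min ((c q + x) ^ 2) 1 := le_min (sq_nonneg _) zero_le_one
    rcases le_total (c q ^ 2 / 4) (x ^ 2) with h | h
    · linarith [min_le_min_right 1 h]
    · have h4 : c q ^ 2 / 4 ≤ (c q + x) ^ 2 := by
        have h5 : |x| ≤ |c q| / 2 := by
          rw [← abs_of_pos (by norm_num : (0 : ℝ) < 2), ← abs_div]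
          exact sq_le_sq.1 (by rw [div_pow]; linarith)
        have h6 : |c q| / 2 ≤ |c q + x| := by
          have := abs_sub (c q + x) x
          rw [add_sub_cancel_right] at this
          linarith
        calc c q ^ 2 / 4 = (|c q| / 2) ^ 2 := by rw [div_pow, sq_abs]; norm_num
          _ ≤ |c q + x| ^ 2 := by gcongr
          _ = _ := sq_abs _
      linarith [min_le_min_right 1 h4]
  refine le_trans (le_of_eq ?_) (Finset.card_nsmul_le_sum _ _ _ h1)
  rw [hcard, nsmul_eq_mul]
  obtain ⟨m, rfl⟩ : ∃ m, N = m + 1 := ⟨N - 1, by omega⟩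
  rw [Nat.add_sub_cancel, pow_succ]
  push_cast
  ring

/-- The residues are half of each period, and complete periods cover at least half of `n`. These are
the pixels on the plateau of their bump. -/
lemma le_card_filter_mod {u : ℕ} (hu : 1 ≤ u) (hun : 4 * u ≤ n) :
    n ≤ 4 * (Finset.univ.filter fun a : Fin n =>
      u ≤ (a : ℕ) % (4 * u) ∧ (a : ℕ) % (4 * u) < 3 * u).card := by
  have h1 : n / (4 * u) * (2 * u) ≤ (Finset.univ.filter fun a : Fin n =>
      u ≤ (a : ℕ) % (4 * u) ∧ (a : ℕ) % (4 * u) < 3 * u).card := by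
    rw [← Finset.card_range (n / (4 * u)), ← Finset.card_range (2 * u), ← Finset.card_product]
    have hlt : ∀ x ∈ Finset.range (n / (4 * u)) ×ˢ Finset.range (2 * u),
        4 * u * x.1 + (u + x.2) < n := by
      intro x hx
      obtain ⟨h1, h2⟩ := Finset.mem_product.1 hx
      have h3 := Finset.mem_range.1 h1
      have h4 := Finset.mem_range.1 h2
      have h5 := Nat.mul_div_le n (4 * u)
      have h6 : 4 * u * (x.1 + 1) ≤ 4 * u * (n / (4 * u)) := Nat.mul_le_mul_left _ h3
      rw [mul_add] at h6
      omega
    refine Finset.card_le_card_of_injOn (fun x => if hx : 4 * u * x.1 + (u + x.2) < n then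
      ⟨4 * u * x.1 + (u + x.2), hx⟩ else ⟨0, by omega⟩) (fun x hx => ?_) fun x hx y hy he => ?_
    · have h4 := Finset.mem_range.1 (Finset.mem_product.1 hx).2
      simp only [Finset.coe_filter, Finset.mem_univ, true_and, Set.mem_ofPred_eq, dif_pos (hlt x hx)]
      rw [Nat.mul_add_mod, Nat.mod_eq_of_lt (by omega)]
      omega
    · have h4 := Finset.mem_range.1 (Finset.mem_product.1 hx).2
      have h4' := Finset.mem_range.1 (Finset.mem_product.1 hy).2
      simp only [dif_pos (hlt x hx), dif_pos (hlt y hy), Fin.mk.injEq] at he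
      have h5 : x.1 = y.1 := by
        have : (4 * u * x.1 + (u + x.2)) / (4 * u) = (4 * u * y.1 + (u + y.2)) / (4 * u) := by
          rw [he]
        rwa [Nat.mul_add_div (by omega), Nat.mul_add_div (by omega),
          Nat.div_eq_of_lt (by omega), Nat.div_eq_of_lt (by omega), add_zero, add_zero] at this
      rw [h5] at he
      exact Prod.ext h5 (by omega)
  have h2 := Nat.div_add_mod n (4 * u)
  have h3 := Nat.mod_lt n (show 0 < 4 * u by omega)
  have h4 : 1 ≤ n / (4 * u) := (Nat.one_le_div_iff (by omega)).2 hun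
  have h5 : 4 * u ≤ 4 * u * (n / (4 * u)) := Nat.le_mul_of_pos_right _ h4
  have h6 : n / (4 * u) * (2 * u) * 4 = 2 * (4 * u * (n / (4 * u))) := by ring
  omega

lemma le_card_filter_grid (k₀ : Fin d) {u : ℕ} (hu : 1 ≤ u) (hun : 4 * u ≤ n) :
    (n : ℝ) ^ d / 4 ≤ (Finset.univ.filter fun i : Grid d n =>
      u ≤ (i k₀ : ℕ) % (4 * u) ∧ (i k₀ : ℕ) % (4 * u) < 3 * u).card := by
  set S := Finset.univ.filter fun a : Fin n =>
      u ≤ (a : ℕ) % (4 * u) ∧ (a : ℕ) % (4 * u) < 3 * u with hS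
  have h1 : (Finset.univ.filter fun i : Grid d n =>
      u ≤ (i k₀ : ℕ) % (4 * u) ∧ (i k₀ : ℕ) % (4 * u) < 3 * u) =
      Fintype.piFinset (Function.update (fun _ => Finset.univ) k₀ S) := by
    ext i
    rw [Fintype.mem_piFinset, Finset.mem_filter]
    constructor
    · rintro ⟨-, hi⟩ k
      by_cases hk : k = k₀
      · subst hk
        simpa [hS] using hi
      · simp [hk]
    · intro hi
      have := hi k₀
      simpa [hS] using this
  rw [h1, Fintype.card_piFinset, ← Finset.mul_prod_erase _ _ (Finset.mem_univ k₀),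
    Function.update_self]
  have h2 : ∏ k ∈ Finset.univ.erase k₀,
      (Function.update (fun _ : Fin d => (Finset.univ : Finset (Fin n))) k₀ S k).card =
      n ^ (d - 1) := by
    rw [Finset.prod_congr rfl (g := fun _ => n) fun k hk => by
      rw [Function.update_of_ne (Finset.ne_of_mem_erase hk)]; simp]
    simp
  rw [h2]
  have h3 : (n : ℝ) ≤ 4 * S.card := by exact_mod_cast le_card_filter_mod hu hun
  have hd : d = d - 1 + 1 := by have := k₀.pos; omega
  push_cast
  rw [show (n : ℝ) ^ d = n ^ (d - 1) * n by conv_lhs => rw [hd, pow_succ]]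
  nlinarith [pow_nonneg (Nat.cast_nonneg n : (0 : ℝ) ≤ n) (d - 1)]

lemma inv_mul_pt (k₀ : Fin d) (i : Grid d n) (u : ℕ) :
    ((4 * u : ℕ) / n : ℝ)⁻¹ * pt i k₀ = ((i k₀ : ℕ) + 1 / 2) / (4 * u : ℕ) := by
  have hn : (n : ℝ) ≠ 0 := by
    have := (i k₀).pos
    positivity
  rw [pt, inv_div, div_mul_div_comm, mul_comm ((4 * u : ℕ) : ℝ) (n : ℝ), mul_div_mul_left _ _ hn]

lemma unitBump_pixel_eq_zero {l a q : ℕ} (hl : 0 < l) (h : a / l ≠ q) :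
    unitBump (((a : ℝ) + 1 / 2) / l - q) = 0 := by
  have hl' : (0 : ℝ) < l := by exact_mod_cast hl
  refine unitBump_eq_zero ?_
  rcases lt_or_gt_of_ne h with h | h
  · left
    have h1 : a + 1 ≤ l * q := by
      have := Nat.lt_mul_of_div_lt h hl
      rw [mul_comm]
      omega
    have h2 : (a : ℝ) + 1 ≤ l * q := by exact_mod_cast h1
    rw [sub_nonpos, div_le_iff₀ hl']
    linarith
  · right
    have h1 : (q + 1) * l ≤ a := (Nat.le_div_iff_mul_le hl).1 h
    have h2 : ((q : ℝ) + 1) * l ≤ a := by exact_mod_cast h1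
    rw [le_sub_iff_add_le, le_div_iff₀ hl']
    linarith

lemma unitBump_pixel_eq_one {u a : ℕ} (hu : 1 ≤ u) (h1 : u ≤ a % (4 * u))
    (h2 : a % (4 * u) < 3 * u) :
    unitBump (((a : ℝ) + 1 / 2) / (4 * u : ℕ) - (a / (4 * u) : ℕ)) = 1 := by
  have hu' : (0 : ℝ) < (4 * u : ℕ) := by positivity
  have h3 := Nat.div_add_mod a (4 * u)
  have h4 : (a : ℝ) = (4 * u : ℕ) * (a / (4 * u) : ℕ) + (a % (4 * u) : ℕ) := by exact_mod_cast h3.symm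
  have h5 : ((a : ℝ) + 1 / 2) / (4 * u : ℕ) - (a / (4 * u) : ℕ) =
      (((a % (4 * u) : ℕ) : ℝ) + 1 / 2) / (4 * u : ℕ) := by
    rw [div_sub' hu'.ne']
    congr 1
    linarith
  have h6 : (u : ℝ) ≤ (a % (4 * u) : ℕ) := by exact_mod_cast h1
  have h7 : ((a % (4 * u) : ℕ) : ℝ) + 1 ≤ 3 * u := by exact_mod_cast h2
  have h8 : ((4 * u : ℕ) : ℝ) = 4 * u := by push_cast; ring
  rw [h5]
  refine unitBump_eq_one ?_ ?_
  · rw [le_div_iff₀ hu', h8]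
    linarith
  · rw [div_le_iff₀ hu', h8]
    linarith

lemma min_sq_sub_ge {a ψ η : ℝ} (ha0 : 0 ≤ a) (ha1 : a ≤ 1) (hψ0 : 0 ≤ ψ) (hψ1 : ψ ≤ 1) :
    a ^ 2 / 4 * (ψ ^ 2 / 4 - η ^ 2) ≤ min ((a * (η - ψ)) ^ 2 / 4) 1 := by
  have ha2 : a ^ 2 ≤ 1 := pow_le_one₀ ha0 ha1
  have hψ2 : ψ ^ 2 ≤ 1 := pow_le_one₀ hψ0 hψ1
  refine le_min ?_ ?_
  · have : ψ ^ 2 / 4 - η ^ 2 ≤ (η - ψ) ^ 2 := by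
      nlinarith [sq_nonneg (η - ψ / 2), sq_nonneg (η - ψ * (3 / 4)), sq_nonneg (2 * η - ψ)]
    calc a ^ 2 / 4 * (ψ ^ 2 / 4 - η ^ 2) ≤ a ^ 2 / 4 * (η - ψ) ^ 2 := by gcongr
      _ = _ := by ring
  · have h1 : ψ ^ 2 / 4 - η ^ 2 ≤ 1 := by nlinarith [sq_nonneg η]
    calc a ^ 2 / 4 * (ψ ^ 2 / 4 - η ^ 2) ≤ a ^ 2 / 4 * 1 := by gcongr
      _ ≤ 1 := by linarith

/-- The bias of the membership oracle estimator for a train of bumps. -/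
lemma trainImage_bias (hα : 0 < α) (hC₀ : 2 ≤ C₀) (k₀ : Fin d) {B : ℝ} (hB2 : 2 ≤ B)
    (hB : ∀ k ≤ holderOrder α + 1, ∀ y, |iteratedDeriv k unitBump y| ≤ B) {ρ : ℝ} (hρ0 : 0 < ρ)
    (hρ1 : ρ ≤ 1) (s : Finset ℕ) (r : ℕ) {h : ℝ} (hh : 0 < h) {Ω : Set (Fin d → ℝ)}
    (hΩ : (trainImage hα hC₀ k₀ hB2 hB hρ0 hρ1 s).Ω = Ω) (i : Grid d n) :
    (∑ j, fitWeight r Ω h i j * (trainImage hα hC₀ k₀ hB2 hB hρ0 hρ1 s).toFun (pt j)) -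
        (trainImage hα hC₀ k₀ hB2 hB hρ0 hρ1 s).toFun (pt i) =
      ∑ q ∈ s, 1 / (4 * B) * ρ ^ α * ((∑ j, fitWeight r Ω h i j *
        unitBump (ρ⁻¹ * pt j k₀ - q)) - unitBump (ρ⁻¹ * pt i k₀ - q)) := by
  classical
  have h1 : ∀ j, fitWeight r Ω h i j * (trainImage hα hC₀ k₀ hB2 hB hρ0 hρ1 s).toFun (pt j) =
      fitWeight r Ω h i j * (if pt i ∈ Ω then 5 / 8 else 1 / 8) +
        1 / (4 * B) * ρ ^ α * (fitWeight r Ω h i j * bumpTrain s (ρ⁻¹ * pt j k₀)) := by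
    intro j
    -- On the window the base level `5 / 8` or `1 / 8` is constant, thanks to the oracle, and
    -- constants are reproduced; only the bumps contribute bias.
    by_cases hj : j ∈ window Ω h i
    · rw [trainImage_toFun, hΩ, if_congr (mem_window.1 hj).2 rfl rfl]
      ring
    · have : fitWeight r Ω h i j = 0 := hatWeight_eq_zero _ _ hj
      rw [this]
      ring
  rw [Finset.sum_congr rfl fun j _ => h1 j, Finset.sum_add_distrib, ← Finset.sum_mul,
    sum_fitWeight r Ω hh i, one_mul, trainImage_toFun, hΩ, ← Finset.mul_sum, ← Finset.mul_sum]
  have h2 : ∑ j, fitWeight r Ω h i j * bumpTrain s (ρ⁻¹ * pt j k₀) =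
      ∑ q ∈ s, ∑ j, fitWeight r Ω h i j * unitBump (ρ⁻¹ * pt j k₀ - q) := by
    simp only [bumpTrain, Finset.mul_sum]
    rw [Finset.sum_comm]
  rw [h2, Finset.sum_sub_distrib, bumpTrain]
  ring

/-- At pixel `i`, the bump of its own cell has value `ψ i` and fitted value `η i`. The squares of
`ψ` sum to at least `n ^ d / 4`, those of `η` to at most `n ^ d / 32`, so most of the bump is lost
as bias. -/
lemma exists_ofReal_bias_le_moRisk (hd : 1 ≤ d) (hα : 0 < α) (hC₀ : 2 ≤ C₀) (r : ℕ) {κ : ℝ}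
    (hκ : 0 < κ) :
    ∃ (T₀ : ℕ) (c : ℝ), 0 < c ∧ ∀ (n : ℕ) (σ : ℝ) (clip : Bool) (P : Measure (Grid d n → ℝ)),
      IsDetected clip σ κ P → ∀ h : ℝ, 0 < h → T₀ ≤ pixelRadius n h → 1 ≤ n →
        ENNReal.ofReal (c * (pixelRadius n h / n : ℝ) ^ (2 * α)) ≤ moRisk clip r α C₀ P h := by
  obtain ⟨B, hB2, hB⟩ := exists_bound_iteratedDeriv_unitBump (holderOrder α + 1)
  have hB0 : 0 < B := by linarith
  set k₀ : Fin d := ⟨0, hd⟩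
  -- The ratio of window radius to bump width, chosen large enough for the bound on the sum of `η i
  -- ^ 2`. Bumps are `4 * u` pixels wide, and `T₀ = 4 * p` makes `u ≥ 1`.
  set p : ℕ := 64 * polyDim d r * 3 ^ (d - 1) * 2 ^ d + 1 with hp
  have hp0 : (0 : ℝ) < p := by positivity
  refine ⟨4 * p, κ * ((1 / (4 * B)) ^ 2 * (1 / (2 * p : ℝ)) ^ (2 * α) / 256), by positivity, ?_⟩
  intro n σ clip P hP h hh hT hn
  set t := pixelRadius n h with ht
  have htn : t ≤ n := min_le_right _ _
  have hn' : (0 : ℝ) < n := by exact_mod_cast hn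
  set u := t / (4 * p) with hu
  have hu1 : 1 ≤ u := (Nat.one_le_div_iff (by omega)).2 hT
  have hdm := Nat.div_add_mod t (4 * p)
  have hml := Nat.mod_lt t (show 0 < 4 * p by omega)
  rw [← hu] at hdm
  have hup : 4 * u * p ≤ t := by
    have : 4 * u * p = 4 * p * u := by ring
    omega
  have htp : t ≤ 2 * p * (4 * u) := by
    have h1 : 4 * p ≤ 4 * p * u := Nat.le_mul_of_pos_right _ hu1
    have h2 : 2 * p * (4 * u) = 2 * (4 * p * u) := by ring
    omega
  have hut : 4 * u ≤ t := (Nat.le_mul_of_pos_right _ (by omega)).trans hup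
  have hun : 4 * u ≤ n := hut.trans htn
  have ht1 : 1 ≤ t := by omega
  have ht0 : (0 : ℝ) < t := by exact_mod_cast ht1
  have hl0 : 0 < 4 * u := by omega
  have hl0' : (0 : ℝ) < (4 * u : ℕ) := by exact_mod_cast hl0
  set ρ : ℝ := (4 * u : ℕ) / n with hρ
  have hρ0 : 0 < ρ := by positivity
  have hρ1 : ρ ≤ 1 := (div_le_one hn').2 (by exact_mod_cast hun)
  set a := 1 / (4 * B) * ρ ^ α with ha
  have ha0 : 0 < a := by positivity
  have ha1 : a ≤ 1 := by
    calc a ≤ 1 / (4 * 2) * 1 := by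
          rw [ha]
          gcongr
          exact Real.rpow_le_one hρ0.le hρ1 hα.le
      _ ≤ 1 := by norm_num
  let F := trainImage (d := d) hα hC₀ k₀ hB2 hB hρ0 hρ1
  set Ω := (F ∅).Ω with hΩ
  -- The foreground, hence the weights, do not depend on `s`, so the bias is additive over the bumps
  -- in `s`.
  have hFΩ : ∀ s, (F s).Ω = Ω := fun s => rfl
  let w : Grid d n → Grid d n → ℝ := fitWeight r Ω h
  let bias : Finset ℕ → Grid d n → ℝ := fun s i =>
    (∑ j, w i j * (F s).toFun (pt j)) - (F s).toFun (pt i)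
  let coef : Grid d n → ℕ → ℝ := fun i q => a * ((∑ j, w i j *
        unitBump (ρ⁻¹ * pt j k₀ - q)) - unitBump (ρ⁻¹ * pt i k₀ - q))
  have hbias : ∀ s i, bias s i = ∑ q ∈ s, coef i q := fun s i =>
    trainImage_bias hα hC₀ k₀ hB2 hB hρ0 hρ1 s r hh (hFΩ s) i
  let cell : Grid d n → ℕ := fun i => (i k₀ : ℕ) / (4 * u)
  let ψ : Grid d n → ℝ := fun i => unitBump (ρ⁻¹ * pt i k₀ - cell i)
  let η : Grid d n → ℝ := fun i => ∑ j, w i j * unitBump (ρ⁻¹ * pt j k₀ - cell i)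
  have hη : ∀ i, η i ^ 2 ≤ (4 * u : ℕ) * (2 * t + 1) ^ (d - 1) * w i i := by
    intro i
    refine (sq_sum_hatWeight_mul_le (localPoly r i) (window Ω h i) (self_mem_window Ω hh i)
      (Finset.univ.filter fun j : Grid d n => (j k₀ : ℕ) / (4 * u) = cell i)
      (fun j _ hj => ?_) (B := 1) fun j _ => ?_).trans ?_
    · rw [hρ, inv_mul_pt]
      refine unitBump_pixel_eq_zero hl0 fun hc => hj ?_
      rw [Finset.mem_filter]
      exact ⟨Finset.mem_univ _, hc⟩
    · exact pow_le_one₀ unitBump.nonneg unitBump.le_one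
    · rw [one_mul]
      refine mul_le_mul_of_nonneg_right ?_ (fitWeight_self_nonneg r Ω hh i)
      exact_mod_cast card_window_inter_slab_le Ω hh i k₀ hl0 (cell i)
  have hηsum : ∑ i, η i ^ 2 ≤ (n : ℝ) ^ d / 32 := by
    calc ∑ i, η i ^ 2 ≤ ∑ i, ((4 * u : ℕ) : ℝ) * (2 * t + 1) ^ (d - 1) * w i i :=
          Finset.sum_le_sum fun i _ => hη i
      _ = ((4 * u : ℕ) : ℝ) * (2 * t + 1) ^ (d - 1) * ∑ i, w i i := by rw [Finset.mul_sum]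
      _ ≤ (t / p : ℝ) * (3 * t) ^ (d - 1) * (2 * polyDim d r * (2 * n / t) ^ d) := by
          have h1 : ((4 * u : ℕ) : ℝ) ≤ t / p := by
            rw [le_div_iff₀ hp0]
            exact_mod_cast hup
          have h2 : (2 * t + 1 : ℝ) ≤ 3 * t := by
            have : (1 : ℝ) ≤ t := by exact_mod_cast ht1
            linarith
          have h3 := sum_leverage_le (n := n) r Ω hh ht1
          have h4 : 0 ≤ ∑ i, w i i := Finset.sum_nonneg fun i _ => fitWeight_self_nonneg r Ω hh i
          gcongr
          exact h3
      _ = (64 * polyDim d r * 3 ^ (d - 1) * 2 ^ d : ℝ) / p * ((n : ℝ) ^ d / 32) := by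
          have e : (t : ℝ) ^ d = t ^ (d - 1) * t := by
            rw [← pow_succ, Nat.sub_add_cancel hd]
          rw [div_pow, mul_pow, mul_pow, e]
          field_simp
          ring
      _ ≤ 1 * ((n : ℝ) ^ d / 32) := by
          gcongr
          rw [div_le_one hp0, hp]
          push_cast
          linarith
      _ = _ := one_mul _
  have hψsum : (n : ℝ) ^ d / 4 ≤ ∑ i, ψ i ^ 2 := by
    refine (le_card_filter_grid k₀ hu1 hun).trans ?_
    rw [Finset.card_eq_sum_ones, Nat.cast_sum]
    refine (Finset.sum_le_sum fun i hi => ?_).trans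
      (Finset.sum_le_sum_of_subset_of_nonneg (Finset.subset_univ _) fun i _ _ => sq_nonneg (ψ i))
    obtain ⟨-, h1, h2⟩ := Finset.mem_filter.1 hi
    have : ψ i = 1 := by
      simp only [ψ, cell]
      rw [hρ, inv_mul_pt]
      exact unitBump_pixel_eq_one hu1 h1 h2
    rw [this]
    norm_num
  have hcoef : ∀ i, a ^ 2 / 4 * (ψ i ^ 2 / 4 - η i ^ 2) ≤ min (coef i (cell i) ^ 2 / 4) 1 :=
    fun i => min_sq_sub_ge ha0.le ha1 unitBump.nonneg unitBump.le_one
  have hcell : ∀ i, cell i < n := fun i => (Nat.div_le_self _ _).trans_lt (i k₀).2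
  -- Average over all subsets of the cells: the contribution of the own cell survives on average,
  -- whatever the other coefficients are. The constant is `(1 / 16 - 1 / 32) / 8`.
  have havg : 2 ^ n * (a ^ 2 * n ^ d / 256) ≤
      ∑ s ∈ (Finset.range n).powerset, ∑ i, min (bias s i ^ 2) 1 := by
    rw [Finset.sum_comm]
    calc (2 : ℝ) ^ n * (a ^ 2 * n ^ d / 256)
        ≤ 2 ^ n * (∑ i, a ^ 2 / 4 * (ψ i ^ 2 / 4 - η i ^ 2) / 2) := by
          gcongr
          rw [← Finset.sum_div, ← Finset.mul_sum, Finset.sum_sub_distrib, ← Finset.sum_div]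
          have ha2 : 0 ≤ a ^ 2 := sq_nonneg a
          nlinarith [mul_le_mul_of_nonneg_left (show (n : ℝ) ^ d / 32 ≤
            (∑ i, ψ i ^ 2) / 4 - ∑ i, η i ^ 2 by linarith) ha2]
      _ = ∑ i, 2 ^ n * (a ^ 2 / 4 * (ψ i ^ 2 / 4 - η i ^ 2) / 2) := by rw [Finset.mul_sum]
      _ ≤ _ := by
          refine Finset.sum_le_sum fun i _ => ?_
          simp_rw [hbias]
          refine le_trans ?_ (le_sum_powerset_min_sq (coef i) (hcell i))
          gcongr
          exact hcoef i
  obtain ⟨s, -, hs⟩ : ∃ s ∈ (Finset.range n).powerset,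
      a ^ 2 * n ^ d / 256 ≤ ∑ i, min (bias s i ^ 2) 1 := by
    refine Finset.exists_le_of_sum_le (Finset.powerset_nonempty _) ?_
    rw [Finset.sum_const, Finset.card_powerset, Finset.card_range, nsmul_eq_mul]
    exact_mod_cast havg
  refine le_trans ?_ (le_iSup _ (F s))
  refine le_trans (ENNReal.ofReal_le_ofReal ?_) (le_mse_moEstimator (F s) hP hκ.le r hn hh
    fun i => trainImage_toFun_mem_Icc hα hC₀ _ hB2 hB hρ0 hρ1 s _)
  rw [le_div_iff₀ (by positivity)]
  have hsum : ∑ i, κ * min (bias s i ^ 2) 1 ≤ ∑ i : Grid d n, κ * min (max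
        (((∑ j, fitWeight r (F s).Ω h i j * (F s).toFun (pt j)) - (F s).toFun (pt i)) ^ 2)
          (σ ^ 2 * fitWeight r (F s).Ω h i i)) 1 := by
    refine Finset.sum_le_sum fun i _ => ?_
    gcongr
    exact le_max_left _ _
  refine le_trans ?_ hsum
  rw [← Finset.mul_sum]
  have hρt : 1 / (2 * p : ℝ) * (t / n) ≤ ρ := by
    rw [hρ, div_mul_div_comm, one_mul, div_le_div_iff₀ (by positivity) hn']
    have : (t : ℝ) ≤ 2 * p * (4 * u : ℕ) := by exact_mod_cast htp
    nlinarith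
  have ha2 : (1 / (4 * B)) ^ 2 * ((1 / (2 * p : ℝ)) ^ (2 * α) * (t / n : ℝ) ^ (2 * α)) ≤ a ^ 2 := by
    rw [ha, mul_pow, ← Real.mul_rpow (by positivity) (by positivity)]
    gcongr
    rw [← Real.rpow_natCast, ← Real.rpow_mul hρ0.le, mul_comm α]
    exact Real.rpow_le_rpow (by positivity) hρt (by positivity)
  calc _ = κ * (((1 / (4 * B)) ^ 2 * ((1 / (2 * p : ℝ)) ^ (2 * α) * (t / n : ℝ) ^ (2 * α))) *
        n ^ d / 256) := by ring
    _ ≤ κ * (a ^ 2 * n ^ d / 256) := by gcongr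
    _ ≤ _ := by gcongr

end Lower

/-! ### Rates and optimal bandwidths -/

section Rates

variable {d : ℕ} {α C₀ : ℝ}

lemma pixelRadius_le_mul (n : ℕ) {h : ℝ} (hh : 0 < h) : (pixelRadius n h : ℝ) ≤ n * h := by
  refine le_trans ?_ (Nat.floor_le (by positivity : (0 : ℝ) ≤ n * h))
  exact_mod_cast min_le_left _ _

lemma mul_lt_pixelRadius_add_one {n : ℕ} {h : ℝ} (ht : pixelRadius n h < n) :
    n * h < pixelRadius n h + 1 := by
  rcases min_choice ⌊n * h⌋₊ n with hc | hc
  · rw [pixelRadius, hc]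
    exact Nat.lt_floor_add_one _
  · rw [pixelRadius, hc] at ht
    exact absurd ht (lt_irrefl _)

/-- The lower bound, for any noise for which both bias and variance are detected. -/
lemma exists_rateMO_le_moBestRisk (hd : 1 ≤ d) (hα : 0 < α) (hC₀ : 2 ≤ C₀) (r : ℕ) {κ : ℝ}
    (hκ : 0 < κ) (clip : Bool) :
    ∃ M c : ℝ, 0 < M ∧ 0 < c ∧ ∀ (n : ℕ) (σ : ℝ), 1 ≤ n → 0 < σ →
      M / n ≤ hMO d n α σ → hMO d n α σ ≤ 1 / M → ∀ P : Measure (Grid d n → ℝ),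
        IsDetected clip σ κ P →
          ENNReal.ofReal (c * rateMO d n α σ) ≤ moBestRisk clip r α C₀ P := by
  obtain ⟨T₀, c₂, hc₂, hB⟩ := exists_ofReal_bias_le_moRisk (α := α) (C₀ := C₀) hd hα hC₀ r hκ
  refine ⟨4 * T₀ + 2, min κ (c₂ * (1 / 4) ^ (2 * α)), by positivity, by positivity, ?_⟩
  intro n σ hn hσ hM1 hM2 P hP
  have hH := hMO_pos (d := d) (α := α) hn hσ
  have hR := rateMO_eq (d := d) (α := α) (σ := σ) hn
  have hσ2 := sq_eq_hMO (d := d) hα hn hσ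
  set H := hMO d n α σ
  set R := rateMO d n α σ
  have hn' : (0 : ℝ) < n := by exact_mod_cast hn
  have hT0 : (0 : ℝ) ≤ T₀ := Nat.cast_nonneg _
  have hH1 : H ≤ 1 := hM2.trans ((div_le_one (by positivity)).2 (by linarith))
  have hR0 : 0 ≤ R := hR ▸ Real.rpow_nonneg hH.le _
  have hR1 : R ≤ 1 := hR ▸ Real.rpow_le_one hH.le hH1 (by positivity)
  have hnH : 4 * T₀ + 2 ≤ n * H := by
    rw [div_le_iff₀ hn'] at hM1
    linarith
  refine le_iInf₂ fun h hh => ?_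
  -- Small windows have variance at least the rate. Otherwise `n H ≥ 4 T₀ + 2` gives `t ≥ n H / 4`
  -- and `t ≥ T₀`, and the bias is large.
  rcases le_or_gt (2 * pixelRadius n h + 1 : ℝ) (n * H) with hle | hlt
  · refine le_trans (ENNReal.ofReal_le_ofReal ?_)
      (ofReal_variance_le_moRisk hd hα hC₀ hP hκ.le r hn hh)
    refine mul_le_mul (min_le_left _ _) (le_min ?_ hR1) hR0 hκ.le
    rw [le_div_iff₀ (by positivity), hσ2, mul_comm]
    gcongr
  · have ht : n * H / 4 ≤ pixelRadius n h := by linarith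
    have hTt : T₀ ≤ pixelRadius n h := by
      have : (T₀ : ℝ) ≤ pixelRadius n h := by linarith
      exact_mod_cast this
    refine le_trans (ENNReal.ofReal_le_ofReal ?_) (hB n σ clip P hP h hh hTt hn)
    calc min κ (c₂ * (1 / 4) ^ (2 * α)) * R ≤ c₂ * (1 / 4) ^ (2 * α) * R :=
          mul_le_mul_of_nonneg_right (min_le_right _ _) hR0
      _ = c₂ * (1 / 4 * H) ^ (2 * α) := by
          rw [Real.mul_rpow (by norm_num) hH.le, hR, mul_assoc]
      _ ≤ _ := by
          gcongr
          rw [le_div_iff₀ hn']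
          linarith

/-- Bandwidths which are optimal up to a constant factor, for any noise for which both bias and
variance are detected. -/
lemma exists_optimal_bandwidth_bounds (hd : 1 ≤ d) (hα : 0 < α) (hC₀ : 2 ≤ C₀) (r : ℕ) {κ C K : ℝ}
    (hκ : 0 < κ) (hC : 0 < C) (hK : 1 ≤ K) (clip : Bool) :
    ∃ M a b : ℝ, 0 < M ∧ 0 < a ∧ a ≤ b ∧ ∀ (n : ℕ) (σ : ℝ), 1 ≤ n → 0 < σ →
      M / n ≤ hMO d n α σ → hMO d n α σ ≤ 1 / M → ∀ P : Measure (Grid d n → ℝ),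
        IsDetected clip σ κ P →
        (hMO d n α σ ≤ 1 → moBestRisk clip r α C₀ P ≤ ENNReal.ofReal (C * rateMO d n α σ)) →
        ∀ h : ℝ, 0 < h → moRisk clip r α C₀ P h ≤ ENNReal.ofReal K * moBestRisk clip r α C₀ P →
          a * hMO d n α σ ≤ h ∧ h ≤ b * hMO d n α σ := by
  obtain ⟨T₀, c₂, hc₂, hB⟩ := exists_ofReal_bias_le_moRisk (α := α) (C₀ := C₀) hd hα hC₀ r hκ
  have hT0 : (0 : ℝ) ≤ T₀ := Nat.cast_nonneg _
  have hK0 : 0 < K := by linarith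
  set L := K * C / κ + 1 with hL
  have hL1 : 1 ≤ L := by
    have : 0 ≤ K * C / κ := by positivity
    linarith
  set L₂ := (K * C / c₂) ^ (1 / (2 * α)) with hL₂
  have hL₂0 : 0 < L₂ := by positivity
  set Lα := (2 * L) ^ (1 / (2 * α)) with hLα
  have hLα0 : 0 < Lα := by positivity
  -- Each summand serves one step: `Lα` rules out saturation of the variance bound, `2 * L` absorbs
  -- the `+ 1` in the window size, `4 * L * T₀` gives `T₀ ≤ t`, and `2 * L₂` keeps `t` below the cap
  -- `n`.
  set M := 2 + Lα + 2 * L + 4 * L * T₀ + 2 * L₂ with hM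
  have hLT : 0 ≤ 4 * L * T₀ := by positivity
  have hM0 : 0 < M := by linarith
  refine ⟨M, 1 / (4 * L), max (1 / (4 * L)) (2 * L₂), hM0, by positivity, le_max_left _ _, ?_⟩
  intro n σ hn hσ hM1 hM2 P hP hup h hh hrisk
  have hH := hMO_pos (d := d) (α := α) hn hσ
  have hR := rateMO_eq (d := d) (α := α) (σ := σ) hn
  have hσ2 := sq_eq_hMO (d := d) hα hn hσ
  set H := hMO d n α σ
  set R := rateMO d n α σ
  have hn' : (0 : ℝ) < n := by exact_mod_cast hn
  have hH1 : H ≤ 1 := hM2.trans ((div_le_one hM0).2 (by linarith))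
  have hRpos : 0 < R := hR ▸ Real.rpow_pos_of_pos hH _
  have hnH : M ≤ n * H := by
    rw [div_le_iff₀ hn'] at hM1
    linarith
  have hHM : H * M ≤ 1 := (le_div_iff₀ hM0).1 hM2
  have hle : moRisk clip r α C₀ P h ≤ ENNReal.ofReal (K * C * R) := by
    refine hrisk.trans ?_
    rw [mul_assoc, ENNReal.ofReal_mul hK0.le]
    gcongr
    exact hup hH1
  have hKCR : 0 ≤ K * C * R := by positivity
  have hvar := (ENNReal.ofReal_le_ofReal_iff hKCR).1
    ((ofReal_variance_le_moRisk hd hα hC₀ hP hκ.le r hn hh).trans hle)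
  set t := pixelRadius n h with ht
  have hLR : L * R < 1 := by
    have h1 : 2 * L * R ≤ 1 := by
      calc 2 * L * R = (Lα * H) ^ (2 * α) := by
            rw [Real.mul_rpow hLα0.le hH.le, hLα, ← Real.rpow_mul (by positivity),
              one_div_mul_cancel (by positivity), Real.rpow_one, hR]
        _ ≤ 1 := by
            refine Real.rpow_le_one (by positivity) ?_ (by positivity)
            have h0 : H * Lα ≤ H * M := mul_le_mul_of_nonneg_left (by linarith) hH.le
            linarith
    have h2 : 0 < L * R := by positivity
    linarith
  have hvar2 : min (σ ^ 2 / (2 * t + 1) ^ d) 1 ≤ L * R := by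
    have : min (σ ^ 2 / (2 * t + 1) ^ d) 1 ≤ K * C * R / κ := by
      rw [le_div_iff₀ hκ]
      linarith
    calc _ ≤ K * C * R / κ := this
      _ ≤ K * C * R / κ + R := by linarith
      _ = L * R := by rw [hL]; ring
  have hvar3 : σ ^ 2 / (2 * t + 1) ^ d ≤ L * R := by
    rcases min_le_iff.1 hvar2 with h1 | h1
    · exact h1
    · linarith
  have hnHt : n * H ≤ L * (2 * t + 1) := by
    rw [div_le_iff₀ (by positivity), hσ2] at hvar3
    have h1 : (n * H) ^ d ≤ L * (2 * t + 1) ^ d := by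
      refine le_of_mul_le_mul_right ?_ hRpos
      linarith
    refine le_of_pow_le_pow_left₀ (by omega : d ≠ 0) (by positivity) (h1.trans ?_)
    rw [mul_pow]
    gcongr
    exact le_self_pow₀ hL1 (by omega)
  have htH : n * H ≤ 4 * L * t := by
    have h1 : L * (2 * t + 1) = 4 * L * t / 2 + L := by ring
    linarith
  have hTt : T₀ ≤ t := by
    have h1 : 4 * L * (T₀ : ℝ) ≤ 4 * L * t := by linarith
    exact Nat.cast_le.1 (le_of_mul_le_mul_left h1 (by positivity))
  have ht0 : (0 : ℝ) < t := by
    have : 0 < 4 * L * (t : ℝ) := by linarith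
    exact (mul_pos_iff_of_pos_left (by positivity)).1 this
  have ht1 : (1 : ℝ) ≤ t := by exact_mod_cast (Nat.cast_pos.1 ht0)
  have hbias := (ENNReal.ofReal_le_ofReal_iff hKCR).1 ((hB n σ clip P hP h hh hTt hn).trans hle)
  rw [← ht] at hbias
  have htn : (t / n : ℝ) ≤ L₂ * H := by
    rw [← Real.rpow_le_rpow_iff (by positivity) (by positivity) (by positivity : 0 < 2 * α),
      Real.mul_rpow hL₂0.le hH.le, hL₂, ← Real.rpow_mul (by positivity),
      one_div_mul_cancel (by positivity), Real.rpow_one, ← hR, div_mul_eq_mul_div,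
      le_div_iff₀ hc₂]
    linarith
  refine ⟨?_, ?_⟩
  · have h1 := pixelRadius_le_mul n hh
    have h2 : n * H ≤ n * (4 * L * h) := by
      calc n * H ≤ 4 * L * (n * h) := htH.trans (mul_le_mul_of_nonneg_left h1 (by positivity))
        _ = n * (4 * L * h) := by ring
    have h3 := le_of_mul_le_mul_left h2 hn'
    rw [div_mul_eq_mul_div, one_mul, div_le_iff₀ (by positivity)]
    linarith
  -- Only below the cap does `t` control the bandwidth: there `n h < t + 1 ≤ 2 t`.
  · have h1 : (t / n : ℝ) < 1 := by
      have h0 : H * (2 * L₂) ≤ H * M := mul_le_mul_of_nonneg_left (by linarith) hH.le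
      linarith
    have h2 : t < n := by
      rw [div_lt_one hn'] at h1
      exact_mod_cast h1
    have h3 := mul_lt_pixelRadius_add_one (ht ▸ h2)
    rw [← ht] at h3
    rw [div_le_iff₀ hn'] at htn
    have h4 : n * h ≤ n * (2 * L₂ * H) := by
      rw [show n * (2 * L₂ * H) = 2 * (L₂ * H * n) by ring]
      linarith
    exact (le_of_mul_le_mul_left h4 hn').trans
      (mul_le_mul_of_nonneg_right (le_max_right _ _) hH.le)

end Rates

end MembershipOracle

open MembershipOracle in
theorem theorem2 (d r : ℕ) (α C₀ : ℝ) (hd : 1 ≤ d) (hα : 0 < α) (hC₀ : 2 ≤ C₀)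
    (hr : holderOrder α ≤ r) :
    -- Upper bound, with or without clipping, for all uncorrelated noise.
    (∃ C : ℝ, 0 < C ∧ ∀ (n : ℕ) (σ : ℝ), 1 ≤ n → 0 < σ → hMO d n α σ ≤ 1 →
      ∀ (clip : Bool), ∀ P ∈ whiteNoise d n σ,
        moBestRisk clip r α C₀ P ≤ ENNReal.ofReal (C * rateMO d n α σ)) ∧
    -- Every bandwidth of order `hMO` attains it.
    (∀ a b : ℝ, 0 < a → a ≤ b →
      ∃ C : ℝ, 0 < C ∧ ∀ (n : ℕ) (σ : ℝ), 1 ≤ n → 0 < σ → hMO d n α σ ≤ 1 →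
        ∀ (clip : Bool), ∀ P ∈ whiteNoise d n σ,
          ∀ h : ℝ, a * hMO d n α σ ≤ h → h ≤ b * hMO d n α σ →
            moRisk clip r α C₀ P h ≤ ENNReal.ofReal (C * rateMO d n α σ)) ∧
    -- Without clipping for all uncorrelated noise, and with clipping for i.i.d. noise:
    (∀ (clip : Bool) (noise : ∀ n : ℕ, ℝ → Set (Measure (Grid d n → ℝ))),
      ((clip = false ∧ noise = fun n σ => whiteNoise d n σ) ∨
        (clip = true ∧ ∃ ν : Measure ℝ, IsStandardized ν ∧ noise = fun n σ => iidNoise ν d n σ)) →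
      -- lower bound,
      (∃ M c : ℝ, 0 < M ∧ 0 < c ∧ ∀ (n : ℕ) (σ : ℝ), 1 ≤ n → 0 < σ →
        M / n ≤ hMO d n α σ → hMO d n α σ ≤ 1 / M → ∀ P ∈ noise n σ,
          ENNReal.ofReal (c * rateMO d n α σ) ≤ moBestRisk clip r α C₀ P) ∧
      -- and all optimal bandwidths, even up to a constant factor, are of order `hMO`.
      (∀ K : ℝ, 1 ≤ K →
        ∃ M a b : ℝ, 0 < M ∧ 0 < a ∧ a ≤ b ∧ ∀ (n : ℕ) (σ : ℝ), 1 ≤ n → 0 < σ →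
          M / n ≤ hMO d n α σ → hMO d n α σ ≤ 1 / M → ∀ P ∈ noise n σ, ∀ h : ℝ, 0 < h →
            moRisk clip r α C₀ P h ≤ ENNReal.ofReal K * moBestRisk clip r α C₀ P →
              a * hMO d n α σ ≤ h ∧ h ≤ b * hMO d n α σ)) := by
  have hupper : ∀ a b : ℝ, 0 < a → a ≤ b →
      ∃ C : ℝ, 0 < C ∧ ∀ (n : ℕ) (σ : ℝ), 1 ≤ n → 0 < σ → hMO d n α σ ≤ 1 →
        ∀ (clip : Bool), ∀ P ∈ whiteNoise d n σ,
          ∀ h : ℝ, a * hMO d n α σ ≤ h → h ≤ b * hMO d n α σ →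
            moRisk clip r α C₀ P h ≤ ENNReal.ofReal (C * rateMO d n α σ) := fun a b ha hab =>
    exists_moRisk_le_rateMO d r hα (by linarith) hr ha hab
  have hbest : ∃ C : ℝ, 0 < C ∧ ∀ (n : ℕ) (σ : ℝ), 1 ≤ n → 0 < σ → hMO d n α σ ≤ 1 →
      ∀ (clip : Bool), ∀ P ∈ whiteNoise d n σ,
        moBestRisk clip r α C₀ P ≤ ENNReal.ofReal (C * rateMO d n α σ) := by
    obtain ⟨C, hC, h⟩ := hupper 1 1 one_pos le_rfl
    refine ⟨C, hC, fun n σ hn hσ hH clip P hP => ?_⟩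
    exact (iInf₂_le (hMO d n α σ) (hMO_pos hn hσ)).trans
      (h n σ hn hσ hH clip P hP _ (by simp) (by simp))
  refine ⟨hbest, hupper, fun clip noise hnoise => ?_⟩
  -- Both noise models reduce to detection with a constant independent of `n` and `σ`; membership in
  -- `whiteNoise` is kept for comparison with the upper bound.
  obtain ⟨κ, hκ, hdet⟩ : ∃ κ : ℝ, 0 < κ ∧ ∀ (n : ℕ) (σ : ℝ), ∀ P ∈ noise n σ,
      IsDetected clip σ κ P ∧ P ∈ whiteNoise d n σ := by
    rcases hnoise with ⟨rfl, rfl⟩ | ⟨rfl, ν, hν, rfl⟩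
    · exact ⟨1, one_pos, fun n σ P hP => ⟨isDetected_of_mem_whiteNoise hP, hP⟩⟩
    · obtain ⟨κ, hκ, h⟩ := hν.exists_isDetected
      exact ⟨κ, hκ, fun n σ P hP => ⟨h d n σ P hP, iidNoise_subset_whiteNoise hν σ hP⟩⟩
  constructor
  · obtain ⟨M, c, hM, hc, h⟩ := exists_rateMO_le_moBestRisk (α := α) (C₀ := C₀) hd hα hC₀ r hκ clip
    exact ⟨M, c, hM, hc, fun n σ hn hσ h1 h2 P hP => h n σ hn hσ h1 h2 P (hdet n σ P hP).1⟩
  · intro K hK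
    obtain ⟨C, hC, hup⟩ := hbest
    obtain ⟨M, a, b, hM, ha, hab, h⟩ :=
      exists_optimal_bandwidth_bounds (α := α) (C₀ := C₀) hd hα hC₀ r hκ hC hK clip
    exact ⟨M, a, b, hM, ha, hab, fun n σ hn hσ h1 h2 P hP => h n σ hn hσ h1 h2 P (hdet n σ P hP).1
      fun hH => hup n σ hn hσ hH clip P (hdet n σ P hP).2⟩
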